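/- A halfspace on $\{0,1\}^n$ is a function $h\colon\{0,1\}^n\to\{-1,1\}$ of the form $h(x)=\operatorname{sign}\bigl(\sum_{i=1}^n w_ix_i-\theta\bigr)$ for some reals $w_1,\dots,w_n,\theta$ with $\sum_i w_ix_i\neq\theta$ for all $x\in\{0,1\}^n$. For $X\subseteq\mathbb{R}^n$, $f\colon X\to\{-1,1\}$ and an integer $d\ge 0$, let $$R^+(f,d)=\inf_{p,q}\ \sup_{x\in X}\left|f(x)-\frac{p(x)}{q(x)}\right|,$$ where the infimum is over real polynomials $p,q$ in $n$ variables of degree at most $d$ such that $q$ is positive on $X$. **Theorem.** There exist a family of halfspaces $h_n\colon\{0,1\}^n\to\{-1,1\}$, $n=1,2,3,\dots$, and absolute constants $a,b,c>0$ such that for all integers $n\ge 1$ and all integers $d$ with $1\le d\le cn$, $$1-\exp\left\{-\frac{a\,n}{d}\right\}\ \le\ R^+(h_n,d)\ \le\ 1-\exp\left\{-\frac{b\,n}{d}\right\}.$$ That is, $R^+(h_n,d)=1-\exp\{-\Theta(n/d)\}$ for $d=1,2,\dots,\Theta(n)$. -/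

import Mathlib

open scoped ENNReal

/-- The Boolean cube `{0,1}^n`, viewed as a subset of `ℝ^n`. -/
def boolCube (n : ℕ) : Set (Fin n → ℝ) := {x | ∀ i, x i = 0 ∨ x i = 1}

/-- A function on `{0,1}^n` is a halfspace if it is the sign of an affine form with real
coefficients that vanishes nowhere on `{0,1}^n`. In particular it takes values in `{-1,1}`. -/
def IsHalfspace {n : ℕ} (f : boolCube n → ℝ) : Prop :=
  ∃ (w : Fin n → ℝ) (θ : ℝ), ∀ x : boolCube n,
    ∑ i, w i * x.1 i - θ ≠ 0 ∧ f x = Real.sign (∑ i, w i * x.1 i - θ)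

/-- `R⁺(f, d)` for a function `f` on a set `X ⊆ ℝ^n`: the infimum, over real polynomials `p, q`
in `n` variables of total degree at most `d` with `q` positive on `X`, of the uniform error
`sup_{x ∈ X} |f x - p x / q x|`. It is valued in `[0, ∞]`, so that the supremum is the true one
for every `X` and `f`. -/
noncomputable def RPlus {n : ℕ} {X : Set (Fin n → ℝ)} (f : X → ℝ) (d : ℕ) : ℝ≥0∞ :=
  ⨅ (p : MvPolynomial (Fin n) ℝ) (q : MvPolynomial (Fin n) ℝ)
    (_ : p.totalDegree ≤ d ∧ q.totalDegree ≤ d ∧ ∀ x ∈ X, 0 < MvPolynomial.eval x q),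
    ⨆ x : X, ENNReal.ofReal
      |f x - MvPolynomial.eval x.1 p / MvPolynomial.eval x.1 q|

/-! ### Rational approximation of the sign function on a geometric progression -/

theorem Polynomial.exists_root_mem_Ioo (H : Polynomial ℝ) {a b : ℝ} (hab : a < b)
    (h : H.eval a * H.eval b < 0) : ∃ ξ ∈ Set.Ioo a b, H.eval ξ = 0 := by
  have hc : ContinuousOn (fun x => H.eval x) (Set.Icc a b) := H.continuous.continuousOn
  rcases mul_neg_iff.1 h with ⟨h1, h2⟩ | ⟨h1, h2⟩
  · obtain ⟨x, hx, hx0⟩ := intermediate_value_Ioo' hab.le hc ⟨h2, h1⟩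
    exact ⟨x, hx, hx0⟩
  · obtain ⟨x, hx, hx0⟩ := intermediate_value_Ioo hab.le hc ⟨h1, h2⟩
    exact ⟨x, hx, hx0⟩

theorem Polynomial.two_mul_le_natDegree_of_sign_changes (H : Polynomial ℝ) (hH : H ≠ 0) (m : ℕ)
    (u : ℕ → ℝ) (hu : StrictMono u) (h0 : 0 < u 0)
    (hp : ∀ i < m, H.eval (u i) * H.eval (u (i + 1)) < 0)
    (hn : ∀ i < m, H.eval (-u i) * H.eval (-u (i + 1)) < 0) : 2 * m ≤ H.natDegree := by
  classical
  have h1 : ∀ i, ∃ ξ, i < m → ξ ∈ Set.Ioo (u i) (u (i + 1)) ∧ H.eval ξ = 0 := by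
    intro i
    by_cases hi : i < m
    · obtain ⟨ξ, h, h'⟩ := H.exists_root_mem_Ioo (hu (Nat.lt_succ_self i)) (hp i hi)
      exact ⟨ξ, fun _ => ⟨h, h'⟩⟩
    · exact ⟨0, fun h => absurd h hi⟩
  have h2 : ∀ i, ∃ ξ, i < m → ξ ∈ Set.Ioo (u i) (u (i + 1)) ∧ H.eval (-ξ) = 0 := by
    intro i
    by_cases hi : i < m
    · obtain ⟨ξ, h, h'⟩ := H.exists_root_mem_Ioo (neg_lt_neg (hu (Nat.lt_succ_self i)))
        (by rw [mul_comm]; exact hn i hi)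
      exact ⟨-ξ, fun _ => ⟨⟨by linarith [h.2], by linarith [h.1]⟩, by simpa using h'⟩⟩
    · exact ⟨0, fun h => absurd h hi⟩
  choose ξ hξ using h1
  choose η hη using h2
  have key : ∀ f : ℕ → ℝ, (∀ i < m, f i ∈ Set.Ioo (u i) (u (i + 1))) →
      Set.InjOn f (Finset.range m) := by
    intro f hf i hi j hj hij
    simp only [Finset.coe_range, Set.mem_Iio] at hi hj
    rcases lt_trichotomy i j with h | h | h
    · have := hu.monotone (show i + 1 ≤ j from h)
      have := (hf i hi).2; have := (hf j hj).1; linarith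
    · exact h
    · have := hu.monotone (show j + 1 ≤ i from h)
      have := (hf j hj).2; have := (hf i hi).1; linarith
  have hpos : ∀ i, 0 < u i := fun i => h0.trans_le (hu.monotone (Nat.zero_le i))
  set s := (Finset.range m).image ξ with hs
  set t := (Finset.range m).image (fun i => -η i) with ht
  have hcs : s.card = m := by
    rw [hs, Finset.card_image_of_injOn (key ξ fun i hi => (hξ i hi).1), Finset.card_range]
  have hct : t.card = m := by
    rw [ht, Finset.card_image_of_injOn, Finset.card_range]
    intro i hi j hj hij
    exact key η (fun i hi => (hη i hi).1) hi hj (neg_injective hij)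
  have hdisj : Disjoint s t := by
    rw [Finset.disjoint_left]
    intro a ha hb
    obtain ⟨i, hi, rfl⟩ := Finset.mem_image.1 ha
    obtain ⟨j, hj, hj'⟩ := Finset.mem_image.1 hb
    have := (hξ i (Finset.mem_range.1 hi)).1.1
    have := (hη j (Finset.mem_range.1 hj)).1.1
    have := hpos i; have := hpos j
    linarith
  have hsub : s ∪ t ⊆ H.roots.toFinset := by
    intro a ha
    rw [Multiset.mem_toFinset, Polynomial.mem_roots hH, Polynomial.IsRoot]
    rcases Finset.mem_union.1 ha with h | h
    · obtain ⟨i, hi, rfl⟩ := Finset.mem_image.1 h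
      exact (hξ i (Finset.mem_range.1 hi)).2
    · obtain ⟨i, hi, rfl⟩ := Finset.mem_image.1 h
      exact (hη i (Finset.mem_range.1 hi)).2
  calc 2 * m = (s ∪ t).card := by rw [Finset.card_union_of_disjoint hdisj, hcs, hct, two_mul]
    _ ≤ H.roots.toFinset.card := Finset.card_le_card hsub
    _ ≤ H.roots.card := Multiset.toFinset_card_le _
    _ ≤ H.natDegree := H.card_roots'

theorem prod_lacunary_lower {T t : ℝ} (hT : 1 ≤ T) (ht : 0 < t) (l u : ℕ) :
    t * ∏ j ∈ Finset.range (l + u), (t + T ^ (2 * j + 2)) ≤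
      (t + T ^ (2 * l)) * T ^ u * ∏ j ∈ Finset.range (l + u), (t + T ^ (2 * j + 1)) := by
  have hT0 : 0 < T := by linarith
  induction u with
  | zero =>
    simp only [add_zero, pow_zero, mul_one]
    induction l with
    | zero => simp
    | succ l ih =>
      rw [Finset.prod_range_succ, Finset.prod_range_succ]
      have hP : 0 < ∏ j ∈ Finset.range l, (t + T ^ (2 * j + 1)) :=
        Finset.prod_pos fun j _ => by positivity
      have h2 : T ^ (2 * l) ≤ T ^ (2 * l + 1) := pow_le_pow_right₀ hT (by omega)
      have e : 2 * (l + 1) = 2 * l + 2 := by ring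
      rw [e]
      have h3 : 0 < T ^ (2 * l + 2) := by positivity
      set P := ∏ j ∈ Finset.range l, (t + T ^ (2 * j + 1))
      set Q := ∏ j ∈ Finset.range l, (t + T ^ (2 * j + 2))
      calc t * (Q * (t + T ^ (2 * l + 2))) = (t * Q) * (t + T ^ (2 * l + 2)) := by ring
        _ ≤ ((t + T ^ (2 * l)) * P) * (t + T ^ (2 * l + 2)) := by gcongr
        _ ≤ ((t + T ^ (2 * l + 1)) * P) * (t + T ^ (2 * l + 2)) := by gcongr
        _ = _ := by ring
  | succ u ih =>
    rw [← add_assoc, Finset.prod_range_succ, Finset.prod_range_succ]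
    have hP : 0 < ∏ j ∈ Finset.range (l + u), (t + T ^ (2 * j + 1)) :=
      Finset.prod_pos fun j _ => by positivity
    set P := ∏ j ∈ Finset.range (l + u), (t + T ^ (2 * j + 1))
    set Q := ∏ j ∈ Finset.range (l + u), (t + T ^ (2 * j + 2))
    set r := l + u
    have h1 : t + T ^ (2 * r + 2) ≤ T * (t + T ^ (2 * r + 1)) := by
      have : T ^ (2 * r + 2) = T * T ^ (2 * r + 1) := by ring
      rw [this, mul_add]
      nlinarith
    calc t * (Q * (t + T ^ (2 * r + 2))) = (t * Q) * (t + T ^ (2 * r + 2)) := by ring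
      _ ≤ ((t + T ^ (2 * l)) * T ^ u * P) * (t + T ^ (2 * r + 2)) := by gcongr
      _ ≤ ((t + T ^ (2 * l)) * T ^ u * P) * (T * (t + T ^ (2 * r + 1))) := by gcongr
      _ = _ := by ring

theorem prod_lacunary_upper {T t : ℝ} (hT : 1 ≤ T) (ht : 0 < t) (l u : ℕ) :
    (∏ j ∈ Finset.range (l + u), (t + T ^ (2 * j + 1))) * T ^ u *
        (1 + t / T ^ (2 * (l + u) + 1)) ≤
      (1 + t / T ^ (2 * l + 1)) * ∏ j ∈ Finset.range (l + u), (t + T ^ (2 * j + 2)) := by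
  have hT0 : 0 < T := by linarith
  induction u with
  | zero =>
    simp only [add_zero, pow_zero, mul_one]
    rw [mul_comm]
    refine mul_le_mul_of_nonneg_left (Finset.prod_le_prod (fun j _ => by positivity) fun j _ => ?_)
      (by positivity)
    have := pow_le_pow_right₀ hT (show 2 * j + 1 ≤ 2 * j + 2 by omega)
    linarith
  | succ u ih =>
    rw [← add_assoc, Finset.prod_range_succ, Finset.prod_range_succ]
    have hP : 0 < ∏ j ∈ Finset.range (l + u), (t + T ^ (2 * j + 1)) :=
      Finset.prod_pos fun j _ => by positivity
    set P := ∏ j ∈ Finset.range (l + u), (t + T ^ (2 * j + 1))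
    set Q := ∏ j ∈ Finset.range (l + u), (t + T ^ (2 * j + 2))
    set r := l + u
    have e1 : T * (t + T ^ (2 * r + 1)) = T ^ (2 * r + 2) * (1 + t / T ^ (2 * r + 1)) := by
      field_simp; ring
    have e2 : t + T ^ (2 * r + 2) = T ^ (2 * r + 2) * (1 + t / T ^ (2 * r + 2)) := by
      field_simp; ring
    have h3 : t / T ^ (2 * (r + 1) + 1) ≤ t / T ^ (2 * r + 2) :=
      div_le_div_of_nonneg_left ht.le (by positivity) (pow_le_pow_right₀ hT (by omega))
    calc P * (t + T ^ (2 * r + 1)) * T ^ (u + 1) * (1 + t / T ^ (2 * (r + 1) + 1))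
        = P * T ^ u * (T * (t + T ^ (2 * r + 1))) * (1 + t / T ^ (2 * (r + 1) + 1)) := by ring
      _ = (P * T ^ u * (1 + t / T ^ (2 * r + 1))) *
            (T ^ (2 * r + 2) * (1 + t / T ^ (2 * (r + 1) + 1))) := by rw [e1]; ring
      _ ≤ ((1 + t / T ^ (2 * l + 1)) * Q) *
            (T ^ (2 * r + 2) * (1 + t / T ^ (2 * r + 2))) := by gcongr
      _ = _ := by rw [← e2]; ring

open Polynomial in
/-- If `p / q` has degree `d` and takes values in `[δ, 2]` at `S ^ i` and in `[-2, -δ]` at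
`-S ^ i` for `i ≤ 2 d + 2`, then `δ ≤ 8 / S`. -/
theorem Polynomial.margin_mul_le_of_geometric (p q : ℝ[X]) (d : ℕ) (hp : p.natDegree ≤ d)
    (hq : q.natDegree ≤ d) {S δ : ℝ} (hS : 1 < S) (hδ : 0 < δ)
    (h1 : ∀ i ≤ 2 * d + 2, 0 < q.eval (S ^ i) ∧ δ * q.eval (S ^ i) ≤ p.eval (S ^ i) ∧
      p.eval (S ^ i) ≤ 2 * q.eval (S ^ i))
    (h2 : ∀ i ≤ 2 * d + 2, 0 < q.eval (-S ^ i) ∧ δ * q.eval (-S ^ i) ≤ -p.eval (-S ^ i) ∧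
      -p.eval (-S ^ i) ≤ 2 * q.eval (-S ^ i)) : δ * S ≤ 8 := by
  by_contra! hcon
  have hS0 : 0 < S := by linarith
  obtain ⟨κ, hκ1, hκ2⟩ : ∃ κ, 2 / δ < κ ∧ κ < S / 4 := by
    apply exists_between
    rw [div_lt_div_iff₀ hδ (by norm_num)]
    linarith
  have hκ : 0 < κ := lt_trans (by positivity) hκ1
  set r := d + 1 with hr
  set T := S ^ 2 with hT
  have hT1 : 1 ≤ T := one_le_pow₀ hS.le
  have hT0 : 0 < T := by positivity
  set A : ℝ[X] := ∏ j ∈ Finset.range r, (X ^ 2 + C (T ^ (2 * j + 1))) with hA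
  set B : ℝ[X] := ∏ j ∈ Finset.range r, (X ^ 2 + C (T ^ (2 * j + 2))) with hB
  have evA : ∀ z, A.eval z = ∏ j ∈ Finset.range r, (z ^ 2 + T ^ (2 * j + 1)) := by
    intro z; simp [hA, eval_prod]
  have evB : ∀ z, B.eval z = ∏ j ∈ Finset.range r, (z ^ 2 + T ^ (2 * j + 2)) := by
    intro z; simp [hB, eval_prod]
  have Apos : ∀ z, 0 < A.eval z := by
    intro z; rw [evA]; exact Finset.prod_pos fun j _ => by positivity
  have Bpos : ∀ z, 0 < B.eval z := by
    intro z; rw [evB]; exact Finset.prod_pos fun j _ => by positivity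
  have Aneg : ∀ z, A.eval (-z) = A.eval z := by intro z; simp [evA]
  have Bneg : ∀ z, B.eval (-z) = B.eval z := by intro z; simp [evB]
  have degA : A.natDegree ≤ 2 * r := by
    refine (natDegree_prod_le _ _).trans ?_
    refine (Finset.sum_le_card_nsmul _ _ 2 fun j _ => ?_).trans (by simp [mul_comm])
    compute_degree
  have degB : B.natDegree ≤ 2 * r := by
    refine (natDegree_prod_le _ _).trans ?_
    refine (Finset.sum_le_card_nsmul _ _ 2 fun j _ => ?_).trans (by simp [mul_comm])
    compute_degree
  set H : ℝ[X] := C (κ * T ^ r) * A * p - X * B * q with hH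
  have degH : H.natDegree ≤ 2 * r + 1 + d := by
    refine (natDegree_sub_le _ _).trans (max_le ?_ ?_)
    · refine natDegree_mul_le.trans ?_
      have := natDegree_C_mul_le (κ * T ^ r) A
      omega
    · refine natDegree_mul_le.trans ?_
      have := natDegree_mul_le (p := (X : ℝ[X])) (q := B)
      have := natDegree_X_le (R := ℝ)
      omega
  have evH : ∀ z, H.eval z = κ * T ^ r * A.eval z * p.eval z - z * B.eval z * q.eval z := by
    intro z; simp [hH]
  have even : ∀ l ≤ r, S ^ (2 * l) * B.eval (S ^ (2 * l)) ≤ 2 * T ^ r * A.eval (S ^ (2 * l)) := by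
    intro l hl
    obtain ⟨u, hu⟩ := Nat.exists_eq_add_of_le hl
    have h := prod_lacunary_lower hT1 (show 0 < T ^ (2 * l) by positivity) l u
    have e : (S ^ (2 * l)) ^ 2 = T ^ (2 * l) := by rw [hT, ← pow_mul, ← pow_mul]; ring_nf
    rw [evA, evB, e]
    rw [← hu] at h
    have hTl : 0 < T ^ (2 * l) := by positivity
    set P := ∏ j ∈ Finset.range r, (T ^ (2 * l) + T ^ (2 * j + 1))
    set Q := ∏ j ∈ Finset.range r, (T ^ (2 * l) + T ^ (2 * j + 2))
    have h' : Q ≤ 2 * T ^ u * P := by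
      refine le_of_mul_le_mul_left ?_ hTl
      linarith
    have e2 : S ^ (2 * l) = T ^ l := by rw [hT, ← pow_mul]
    rw [e2, hu, pow_add]
    calc T ^ l * Q ≤ T ^ l * (2 * T ^ u * P) := by gcongr
      _ = _ := by ring
  have odd : ∀ l < r,
      T ^ r * S * A.eval (S ^ (2 * l + 1)) ≤ 2 * (S ^ (2 * l + 1) * B.eval (S ^ (2 * l + 1))) := by
    intro l hl
    obtain ⟨u, hu⟩ := Nat.exists_eq_add_of_le hl.le
    have h := prod_lacunary_upper hT1 (show 0 < T ^ (2 * l + 1) by positivity) l u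
    have e : (S ^ (2 * l + 1)) ^ 2 = T ^ (2 * l + 1) := by
      rw [hT, ← pow_mul, ← pow_mul]; ring_nf
    rw [evA, evB, e]
    rw [← hu, div_self (by positivity)] at h
    have hPp : 0 ≤ ∏ j ∈ Finset.range r, (T ^ (2 * l + 1) + T ^ (2 * j + 1)) :=
      Finset.prod_nonneg fun j _ => by positivity
    set P := ∏ j ∈ Finset.range r, (T ^ (2 * l + 1) + T ^ (2 * j + 1))
    set Q := ∏ j ∈ Finset.range r, (T ^ (2 * l + 1) + T ^ (2 * j + 2))
    have h' : P * T ^ u ≤ 2 * Q := by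
      refine le_trans ?_ (h.trans (by norm_num))
      apply le_mul_of_one_le_right (by positivity)
      have : 0 ≤ T ^ (2 * l + 1) / T ^ (2 * r + 1) := by positivity
      linarith
    have e2 : S ^ (2 * l + 1) = T ^ l * S := by rw [hT, ← pow_mul, pow_succ]
    rw [e2, hu, pow_add]
    calc T ^ l * T ^ u * S * P = T ^ l * S * (P * T ^ u) := by ring
      _ ≤ T ^ l * S * (2 * Q) := by gcongr
      _ = _ := by ring
  have hκδ : 2 < κ * δ := by rwa [div_lt_iff₀ hδ] at hκ1
  have Tr : 0 < T ^ r := by positivity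
  have posE : ∀ l ≤ r, ∀ P Q : ℝ, 0 < Q → δ * Q ≤ P →
      0 < κ * T ^ r * A.eval (S ^ (2 * l)) * P - S ^ (2 * l) * B.eval (S ^ (2 * l)) * Q := by
    intro l hl P Q hQ hPQ
    have ha := Apos (S ^ (2 * l))
    have := even l hl
    set a := A.eval (S ^ (2 * l))
    calc (0 : ℝ) < (κ * δ - 2) * (T ^ r * a * Q) := by
          apply mul_pos (by linarith); positivity
      _ = κ * T ^ r * a * (δ * Q) - 2 * T ^ r * a * Q := by ring
      _ ≤ _ := by gcongr
  have negO : ∀ l < r, ∀ P Q : ℝ, 0 < Q → P ≤ 2 * Q →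
      κ * T ^ r * A.eval (S ^ (2 * l + 1)) * P -
        S ^ (2 * l + 1) * B.eval (S ^ (2 * l + 1)) * Q < 0 := by
    intro l hl P Q hQ hPQ
    have ha := Apos (S ^ (2 * l + 1))
    have := odd l hl
    set a := A.eval (S ^ (2 * l + 1))
    set b := S ^ (2 * l + 1) * B.eval (S ^ (2 * l + 1))
    have h3 : T ^ r * S * a / 2 ≤ b := by linarith
    calc κ * T ^ r * a * P - b * Q ≤ κ * T ^ r * a * (2 * Q) - (T ^ r * S * a / 2) * Q := by gcongr
      _ = (4 * κ - S) * (T ^ r * a * Q / 2) := by ring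
      _ < 0 := by
        apply mul_neg_of_neg_of_pos (by linarith); positivity
  have fpos : ∀ i ≤ 2 * r, (Even i → 0 < H.eval (S ^ i) ∧ H.eval (-S ^ i) < 0) ∧
      (¬ Even i → H.eval (S ^ i) < 0 ∧ 0 < H.eval (-S ^ i)) := by
    intro i hi
    have g1 := h1 i (by omega)
    have g2 := h2 i (by omega)
    rw [evH, evH, Aneg, Bneg]
    constructor
    · rintro ⟨l, rfl⟩
      rw [← two_mul] at *
      refine ⟨posE l (by omega) _ _ g1.1 g1.2.1, ?_⟩
      have := posE l (by omega) _ _ g2.1 g2.2.1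
      linarith
    · intro h
      obtain ⟨l, rfl⟩ := Nat.not_even_iff_odd.1 h
      refine ⟨negO l (by omega) _ _ g1.1 g1.2.2, ?_⟩
      have := negO l (by omega) _ _ g2.1 g2.2.2
      linarith
  have hH0 : H ≠ 0 := by
    intro h
    have := ((fpos 0 (by omega)).1 (by simp)).1
    rw [h] at this
    simp at this
  have main := H.two_mul_le_natDegree_of_sign_changes hH0 (2 * r) (fun i => S ^ i)
    (pow_right_strictMono₀ hS) (by simp)
    (by
      intro i hi
      have a1 := fpos i (by omega)
      have a2 := fpos (i + 1) (by omega)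
      by_cases he : Even i
      · exact mul_neg_of_pos_of_neg (a1.1 he).1 (a2.2 (by rw [Nat.even_add_one]; simpa using he)).1
      · exact mul_neg_of_neg_of_pos (a1.2 he).1 (a2.1 (by rwa [Nat.even_add_one])).1)
    (by
      intro i hi
      have a1 := fpos i (by omega)
      have a2 := fpos (i + 1) (by omega)
      by_cases he : Even i
      · exact mul_neg_of_neg_of_pos (a1.1 he).2 (a2.2 (by rw [Nat.even_add_one]; simpa using he)).2
      · exact mul_neg_of_pos_of_neg (a1.2 he).2 (a2.1 (by rwa [Nat.even_add_one])).2)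
  omega

/-! ### Characters of the cube and affine forms of small discrepancy -/

section Discrepancy

variable {ι : Type*} [Fintype ι] [DecidableEq ι]

/-- The character of `{0,1}^ι` indexed by `S`, at the indicator vector of `A`. -/
def cubeChar (S A : Finset ι) : ℝ := ∏ i ∈ S, if i ∈ A then -1 else 1

theorem cubeChar_eq_prod_univ (S A : Finset ι) :
    cubeChar S A = ∏ i, if i ∈ S then (if i ∈ A then (-1 : ℝ) else 1) else 1 := by
  rw [Finset.prod_ite_mem, Finset.univ_inter, cubeChar]

theorem cubeChar_comm (S A : Finset ι) : cubeChar S A = cubeChar A S := by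
  rw [cubeChar_eq_prod_univ, cubeChar_eq_prod_univ]
  refine Finset.prod_congr rfl fun i _ => ?_
  split_ifs <;> rfl

theorem cubeChar_mul (S T A : Finset ι) :
    cubeChar S A * cubeChar T A = cubeChar (symmDiff S T) A := by
  rw [cubeChar_eq_prod_univ, cubeChar_eq_prod_univ, cubeChar_eq_prod_univ,
    ← Finset.prod_mul_distrib]
  refine Finset.prod_congr rfl fun i _ => ?_
  by_cases h1 : i ∈ S <;> by_cases h2 : i ∈ T <;> by_cases h3 : i ∈ A <;>
    simp [Finset.mem_symmDiff, h1, h2, h3]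

theorem cubeChar_mul_self (S A : Finset ι) : cubeChar S A * cubeChar S A = 1 := by
  rw [cubeChar_mul, symmDiff_self]; simp [cubeChar]

theorem abs_cubeChar (S A : Finset ι) : |cubeChar S A| = 1 := by
  have := cubeChar_mul_self S A
  rw [← abs_mul_abs_self] at this
  nlinarith [abs_nonneg (cubeChar S A)]

omit [Fintype ι] in
@[simp] theorem cubeChar_empty (A : Finset ι) : cubeChar ∅ A = 1 := by simp [cubeChar]

theorem sum_cubeChar (S : Finset ι) (hS : S ≠ ∅) : ∑ A, cubeChar S A = 0 := by
  have h := Finset.prod_one_add (f := fun i => if i ∈ S then (-1 : ℝ) else 1) Finset.univ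
  rw [Finset.powerset_univ] at h
  obtain ⟨i, hi⟩ := Finset.nonempty_iff_ne_empty.2 hS
  rw [Finset.prod_eq_zero (Finset.mem_univ i) (by simp [hi])] at h
  rw [h]
  exact Finset.sum_congr rfl fun A _ => cubeChar_comm S A

omit [Fintype ι] in
theorem ite_subset_eq_sum_cubeChar (U A : Finset ι) :
    (if U ⊆ A then (1 : ℝ) else 0) =
      (1 / 2) ^ U.card * ∑ S ∈ U.powerset, (-1) ^ S.card * cubeChar S A := by
  have h := Finset.prod_one_add (f := fun i => -(if i ∈ A then (-1 : ℝ) else 1)) U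
  have h2 : ∀ S ∈ U.powerset, ∏ i ∈ S, -(if i ∈ A then (-1 : ℝ) else 1) =
      (-1) ^ S.card * cubeChar S A := fun S _ => by rw [Finset.prod_neg]; rfl
  rw [Finset.sum_congr rfl h2] at h
  rw [← h, ← Finset.prod_const, ← Finset.prod_mul_distrib]
  split_ifs with hU
  · rw [Finset.prod_eq_one]
    intro i hi
    rw [if_pos (hU hi)]; norm_num
  · obtain ⟨i, hi, hiA⟩ := Finset.not_subset.1 hU
    rw [Finset.prod_eq_zero hi]
    rw [if_neg hiA]; norm_num

theorem AddMonoidHom.card_fiber_mul_card {G H : Type*} [AddGroup G] [AddGroup H] [Fintype G]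
    [Fintype H] [DecidableEq H] (f : G →+ H) (hf : Function.Surjective f) (y : H) :
    (Finset.univ.filter fun g => f g = y).card * Fintype.card H = Fintype.card G := by
  have h := Finset.card_eq_sum_card_fiberwise (f := f) (s := Finset.univ) (t := Finset.univ)
    (fun _ _ => Finset.mem_coe.2 (Finset.mem_univ _))
  rw [← Finset.card_univ (α := G), h, Finset.sum_congr rfl
    (fun x _ => AddMonoidHom.card_fiber_eq_of_mem_range f (hf x) (hf y))]
  simp [mul_comm]

/-- The values of an affine form modulo `M` at two points of the cube, as a function of the
coefficients. -/
def affinePairHom (M : ℕ) (A B : Finset ι) : ((ι → ZMod M) × ZMod M) →+ ZMod M × ZMod M where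
  toFun ω := (ω.2 + ∑ i ∈ A, ω.1 i, ω.2 + ∑ i ∈ B, ω.1 i)
  map_zero' := by simp
  map_add' x y := by
    simp only [Prod.snd_add, Prod.fst_add, Pi.add_apply, Finset.sum_add_distrib, Prod.mk_add_mk]
    congr 1 <;> abel

omit [Fintype ι] in
theorem affinePairHom_surjective (M : ℕ) {A B : Finset ι} (hAB : A ≠ B) :
    Function.Surjective (affinePairHom M A B) := by
  rintro ⟨a, b⟩
  by_cases h : A ⊆ B
  · obtain ⟨i, hB, hA⟩ := Finset.not_subset.1 (fun h' => hAB (h.antisymm h'))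
    refine ⟨(Pi.single i (b - a), a), ?_⟩
    simp [affinePairHom, hA, hB, Pi.single_apply]
  · obtain ⟨i, hA, hB⟩ := Finset.not_subset.1 h
    refine ⟨(Pi.single i (a - b), b), ?_⟩
    simp [affinePairHom, hA, hB, Pi.single_apply]

variable (M : ℕ) [NeZero M]

theorem sum_ite_affine_eq (A : Finset ι) (z : ZMod M) :
    ∑ ω : (ι → ZMod M) × ZMod M, (if ω.2 + ∑ i ∈ A, ω.1 i = z then (1 : ℝ) else 0) =
      Fintype.card ((ι → ZMod M) × ZMod M) / M := by
  have hM : (M : ℝ) ≠ 0 := Nat.cast_ne_zero.2 (NeZero.ne M)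
  have hs : Function.Surjective ((AddMonoidHom.fst (ZMod M) (ZMod M)).comp
      (affinePairHom M A A)) := fun a => ⟨(0, a), by simp [affinePairHom]⟩
  have h := AddMonoidHom.card_fiber_mul_card _ hs z
  rw [ZMod.card] at h
  rw [← h, Finset.sum_boole]
  push_cast
  rw [mul_div_assoc, div_self hM, mul_one]
  congr 2

theorem sum_ite_affine_eq_mul {A B : Finset ι} (hAB : A ≠ B) (z : ZMod M) :
    ∑ ω : (ι → ZMod M) × ZMod M, (if ω.2 + ∑ i ∈ A, ω.1 i = z then (1 : ℝ) else 0) *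
      (if ω.2 + ∑ i ∈ B, ω.1 i = z then (1 : ℝ) else 0) =
      Fintype.card ((ι → ZMod M) × ZMod M) / M ^ 2 := by
  have hM : (M : ℝ) ≠ 0 := Nat.cast_ne_zero.2 (NeZero.ne M)
  have h := AddMonoidHom.card_fiber_mul_card _ (affinePairHom_surjective M hAB) (z, z)
  rw [Fintype.card_prod (ZMod M), ZMod.card] at h
  simp_rw [mul_ite, mul_one, mul_zero, ← ite_and]
  rw [← h, Finset.sum_boole]
  push_cast
  rw [← pow_two, mul_div_assoc, div_self (pow_ne_zero 2 hM), mul_one]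
  congr 2
  ext ω
  simp [affinePairHom, and_comm]

theorem second_moment_discrepancy (S : Finset ι) (z : ZMod M) :
    ∑ ω : (ι → ZMod M) × ZMod M,
      (∑ A, cubeChar S A * ((if ω.2 + ∑ i ∈ A, ω.1 i = z then (1 : ℝ) else 0) - 1 / M)) ^ 2 ≤
      2 ^ Fintype.card ι * (Fintype.card ((ι → ZMod M) × ZMod M) / M) := by
  have hM : (0 : ℝ) < M := Nat.cast_pos.2 (Nat.pos_of_ne_zero (NeZero.ne M))
  set K : ℝ := (Fintype.card ((ι → ZMod M) × ZMod M) : ℝ) with hK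
  have hK0 : 0 ≤ K := Nat.cast_nonneg _
  set I : (ι → ZMod M) × ZMod M → Finset ι → ℝ :=
    fun ω A => if ω.2 + ∑ i ∈ A, ω.1 i = z then (1 : ℝ) else 0 with hI
  have h1 : ∀ A, ∑ ω, I ω A = K / M := fun A => sum_ite_affine_eq M A z
  have h2 : ∀ A B, ∑ ω, (I ω A - 1 / M) * (I ω B - 1 / M) ≤ (if A = B then K / M else 0) ∧
      (A ≠ B → ∑ ω, (I ω A - 1 / M) * (I ω B - 1 / M) = 0) := by
    intro A B
    have e : ∑ ω, (I ω A - 1 / M) * (I ω B - 1 / M) = ∑ ω, I ω A * I ω B - K / M ^ 2 := by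
      have : ∀ ω, (I ω A - 1 / M) * (I ω B - 1 / M) =
          I ω A * I ω B - I ω A * (1 / M) - I ω B * (1 / M) + 1 / M ^ 2 := by
        intro ω; ring
      simp_rw [this]
      rw [Finset.sum_add_distrib, Finset.sum_sub_distrib, Finset.sum_sub_distrib,
        ← Finset.sum_mul, ← Finset.sum_mul, h1, h1, Finset.sum_const, Finset.card_univ,
        nsmul_eq_mul, ← hK]
      ring
    have e2 : A ≠ B → ∑ ω, (I ω A - 1 / M) * (I ω B - 1 / M) = 0 := by
      intro hAB
      rw [e, sum_ite_affine_eq_mul M hAB, ← hK, sub_self]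
    refine ⟨?_, e2⟩
    split_ifs with h
    · subst h
      have : ∀ ω, I ω A * I ω A = I ω A := by
        intro ω; simp only [hI]; split_ifs <;> simp
      rw [e, Finset.sum_congr rfl fun ω _ => this ω, h1]
      have : 0 ≤ K / M ^ 2 := by positivity
      linarith
    · exact (e2 h).le
  calc ∑ ω, (∑ A, cubeChar S A * (I ω A - 1 / M)) ^ 2
      = ∑ A, ∑ B, cubeChar S A * cubeChar S B *
          ∑ ω, (I ω A - 1 / M) * (I ω B - 1 / M) := by
        simp_rw [pow_two, Finset.sum_mul_sum, Finset.mul_sum]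
        rw [Finset.sum_comm]
        refine Finset.sum_congr rfl fun A _ => ?_
        rw [Finset.sum_comm]
        refine Finset.sum_congr rfl fun B _ => Finset.sum_congr rfl fun ω _ => ?_
        ring
    _ ≤ ∑ A : Finset ι, ∑ B : Finset ι, (if A = B then K / M else 0) := by
        refine Finset.sum_le_sum fun A _ => Finset.sum_le_sum fun B _ => ?_
        by_cases h : A = B
        · subst h
          rw [cubeChar_mul_self, one_mul]
          exact (h2 A A).1
        · rw [(h2 A B).2 h, if_neg h, mul_zero]
    _ = 2 ^ Fintype.card ι * (K / M) := by simp

theorem exists_affine_small_discrepancy (𝒮 : Finset (Finset ι)) :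
    ∃ (w : ι → ZMod M) (w₀ : ZMod M), ∀ z, ∀ S ∈ 𝒮,
      (∑ A, cubeChar S A * ((if w₀ + ∑ i ∈ A, w i = z then (1 : ℝ) else 0) - 1 / M)) ^ 2 ≤
        𝒮.card * 2 ^ Fintype.card ι := by
  have hM : (M : ℝ) ≠ 0 := Nat.cast_ne_zero.2 (NeZero.ne M)
  set F : (ι → ZMod M) × ZMod M → ZMod M → Finset ι → ℝ := fun ω z S =>
    (∑ A, cubeChar S A * ((if ω.2 + ∑ i ∈ A, ω.1 i = z then (1 : ℝ) else 0) - 1 / M)) ^ 2 with hF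
  have hF0 : ∀ ω z S, 0 ≤ F ω z S := fun ω z S => sq_nonneg _
  have htot : ∑ ω, ∑ z, ∑ S ∈ 𝒮, F ω z S ≤
      ∑ _ω : (ι → ZMod M) × ZMod M, (𝒮.card * 2 ^ Fintype.card ι : ℝ) := by
    rw [Finset.sum_comm]
    calc ∑ z, ∑ ω, ∑ S ∈ 𝒮, F ω z S = ∑ z, ∑ S ∈ 𝒮, ∑ ω, F ω z S :=
          Finset.sum_congr rfl fun z _ => Finset.sum_comm
      _ ≤ ∑ _z : ZMod M, ∑ S ∈ 𝒮,
            2 ^ Fintype.card ι * ((Fintype.card ((ι → ZMod M) × ZMod M) : ℝ) / M) :=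
          Finset.sum_le_sum fun z _ => Finset.sum_le_sum fun S _ =>
            second_moment_discrepancy M S z
      _ = _ := by
          simp only [Finset.sum_const, Finset.card_univ, nsmul_eq_mul, ZMod.card]
          field_simp
  obtain ⟨ω, -, hω⟩ := Finset.exists_le_of_sum_le Finset.univ_nonempty htot
  refine ⟨ω.1, ω.2, fun z S hS => le_trans ?_ hω⟩
  exact (Finset.single_le_sum (fun T _ => hF0 ω z T) hS).trans
    (Finset.single_le_sum (f := fun z => ∑ S ∈ 𝒮, F ω z S)
      (fun z _ => Finset.sum_nonneg fun T _ => hF0 ω z T) (Finset.mem_univ z))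

end Discrepancy

/-! ### Distributions on a subset of the cube with prescribed low-degree moments -/

section Moments

variable {ι : Type*} [Fintype ι] [DecidableEq ι]

/-- A subset of the cube on which the characters of low degree nearly cancel carries a probability
distribution all of whose moments up to degree `d` are those of the uniform distribution. -/
theorem exists_distribution_of_sum_cubeChar_le (d : ℕ) (𝒜 : Finset (Finset ι)) (τ : ℝ)
    (hτ : ∀ S : Finset ι, S ≠ ∅ → S.card ≤ 2 * d → |∑ A ∈ 𝒜, cubeChar S A| ≤ τ)
    (hpos : 0 < 𝒜.card)
    (hD : 2 * ((Finset.univ.filter fun S : Finset ι => S.card ≤ d).card : ℝ) * τ < 𝒜.card) :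
    ∃ μ : Finset ι → ℝ, (∀ A, 0 ≤ μ A) ∧ (∀ A, A ∉ 𝒜 → μ A = 0) ∧
      ∀ S : Finset ι, S.card ≤ d → ∑ A, μ A * cubeChar S A = if S = ∅ then 1 else 0 := by
  set J := {S : Finset ι // S.card ≤ d}
  set D : ℝ := ((Finset.univ.filter fun S : Finset ι => S.card ≤ d).card : ℝ) with hDdef
  have hJ : (Fintype.card J : ℝ) = D := by rw [hDdef, Fintype.card_subtype]
  have hJ1 : 1 ≤ D := by
    rw [← hJ]
    have : Nonempty J := ⟨⟨∅, by simp⟩⟩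
    exact_mod_cast Fintype.card_pos
  set n : ℝ := (𝒜.card : ℝ) with hn
  have hn0 : 0 < n := Nat.cast_pos.2 hpos
  set G : Matrix J J ℝ := fun S T => ∑ A ∈ 𝒜, cubeChar S.1 A * cubeChar T.1 A with hG
  have Gdiag : ∀ S, G S S = n := by
    intro S
    simp [hG, cubeChar_mul_self, hn]
  have Goff : ∀ S T, S ≠ T → |G S T| ≤ τ := by
    intro S T hST
    simp only [hG, cubeChar_mul]
    apply hτ
    · intro h
      exact hST (Subtype.ext (symmDiff_eq_bot.1 h))
    · have h1 : (symmDiff S.1 T.1).card ≤ (S.1 ∪ T.1).card :=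
        Finset.card_le_card (by
          intro i; simp only [Finset.mem_symmDiff, Finset.mem_union]; tauto)
      have := Finset.card_union_le S.1 T.1
      have := S.2; have := T.2
      omega
  by_cases hτ0 : 0 ≤ τ
  swap
  · push Not at hτ0
    have huniq : ∀ S : Finset ι, S.card ≤ d → S = ∅ := by
      intro S hS
      by_contra h
      have := (abs_nonneg _).trans (hτ S h (by omega))
      linarith
    refine ⟨fun A => if A ∈ 𝒜 then 1 / n else 0, fun A => ?_, fun A hA => if_neg hA, ?_⟩
    · dsimp only; split_ifs <;> positivity
    · intro S hS
      rw [huniq S hS]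
      simp only [cubeChar_empty, mul_one, if_true, Finset.sum_ite_mem, Finset.univ_inter,
        Finset.sum_const, nsmul_eq_mul]
      rw [← hn]; field_simp
  have hdet : G.det ≠ 0 := by
    apply det_ne_zero_of_sum_row_lt_diag
    intro S
    rw [Gdiag, Real.norm_eq_abs, abs_of_pos hn0]
    calc ∑ T ∈ Finset.univ.erase S, ‖G S T‖ ≤ ∑ T ∈ Finset.univ.erase S, τ :=
          Finset.sum_le_sum fun T hT => Goff S T (Finset.ne_of_mem_erase hT).symm
      _ ≤ ∑ T : J, τ := Finset.sum_le_sum_of_subset_of_nonneg (Finset.erase_subset _ _)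
          fun _ _ _ => hτ0
      _ = D * τ := by rw [Finset.sum_const, Finset.card_univ, nsmul_eq_mul, hJ]
      _ < n := by nlinarith [mul_nonneg (zero_le_one.trans hJ1) hτ0]
  set e : J := ⟨∅, by simp⟩ with he
  set v : J → ℝ := fun S => if S = e then 0 else -(G S e) / n with hv
  set u : J → ℝ := G⁻¹.mulVec v with hu
  have hGu : G.mulVec u = v := by
    rw [hu, Matrix.mulVec_mulVec, Matrix.mul_nonsing_inv _ (isUnit_iff_ne_zero.2 hdet),
      Matrix.one_mulVec]
  obtain ⟨S₀, hS₀⟩ := @Finite.exists_max J ℝ _ ⟨e⟩ _ (fun S => |u S|)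
  set m := |u S₀| with hm
  have hm0 : 0 ≤ m := abs_nonneg _
  have hvS : |v S₀| ≤ τ / n := by
    simp only [hv]
    split_ifs with h
    · rw [abs_zero]; positivity
    · rw [abs_div, abs_neg, abs_of_pos hn0]
      gcongr
      exact Goff _ _ h
  have hmbound : n * m ≤ τ / n + D * τ * m := by
    have h1 := congrFun hGu S₀
    rw [Matrix.mulVec, dotProduct, ← Finset.add_sum_erase _ _ (Finset.mem_univ S₀), Gdiag] at h1
    have h2 : |∑ T ∈ Finset.univ.erase S₀, G S₀ T * u T| ≤ D * τ * m := by
      calc |∑ T ∈ Finset.univ.erase S₀, G S₀ T * u T|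
          ≤ ∑ T ∈ Finset.univ.erase S₀, |G S₀ T * u T| := Finset.abs_sum_le_sum_abs _ _
        _ ≤ ∑ T ∈ Finset.univ.erase S₀, τ * m := by
            refine Finset.sum_le_sum fun T hT => ?_
            rw [abs_mul]
            exact mul_le_mul (Goff _ _ (Finset.ne_of_mem_erase hT).symm) (hS₀ T)
              (abs_nonneg _) hτ0
        _ ≤ ∑ T : J, τ * m := Finset.sum_le_sum_of_subset_of_nonneg (Finset.erase_subset _ _)
            fun _ _ _ => mul_nonneg hτ0 hm0
        _ = D * τ * m := by
            rw [Finset.sum_const, Finset.card_univ, nsmul_eq_mul, hJ, mul_assoc]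
    calc n * m = |n * u S₀| := by rw [abs_mul, abs_of_pos hn0]
      _ = |v S₀ - ∑ T ∈ Finset.univ.erase S₀, G S₀ T * u T| := by rw [← h1]; congr 1; ring
      _ ≤ |v S₀| + |∑ T ∈ Finset.univ.erase S₀, G S₀ T * u T| := abs_sub _ _
      _ ≤ _ := add_le_add hvS h2
  have hDm : D * m ≤ 1 / n := by
    have h1 : n * m ≤ 2 * (τ / n) := by
      nlinarith [mul_le_mul_of_nonneg_right hD.le hm0]
    rw [le_div_iff₀ hn0]
    calc D * m * n = D * (n * m) := by ring
      _ ≤ D * (2 * (τ / n)) := by gcongr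
      _ = (2 * D * τ) / n := by ring
      _ ≤ 1 := by rw [div_le_one hn0]; exact hD.le
  refine ⟨fun A => if A ∈ 𝒜 then 1 / n + ∑ T : J, u T * cubeChar T.1 A else 0, fun A => ?_,
    fun A hA => if_neg hA, ?_⟩
  · dsimp only
    split_ifs
    · have : |∑ T : J, u T * cubeChar T.1 A| ≤ D * m := by
        calc |∑ T : J, u T * cubeChar T.1 A| ≤ ∑ T : J, |u T * cubeChar T.1 A| :=
              Finset.abs_sum_le_sum_abs _ _
          _ ≤ ∑ _T : J, m := Finset.sum_le_sum fun T _ => by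
              rw [abs_mul, abs_cubeChar, mul_one]; exact hS₀ T
          _ = D * m := by rw [Finset.sum_const, Finset.card_univ, nsmul_eq_mul, hJ]
      have := (abs_le.1 this).1
      linarith
    · exact le_rfl
  · intro S hS
    have h1 := congrFun hGu ⟨S, hS⟩
    have h2 : ∑ A ∈ 𝒜, cubeChar S A = G ⟨S, hS⟩ e := by simp [hG, he]
    have h3 : ∑ A ∈ 𝒜, (∑ T : J, u T * cubeChar T.1 A) * cubeChar S A = v ⟨S, hS⟩ := by
      rw [← h1, Matrix.mulVec, dotProduct]
      simp only [hG, Finset.sum_mul]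
      rw [Finset.sum_comm]
      exact Finset.sum_congr rfl fun T _ => Finset.sum_congr rfl fun A _ => by ring
    simp only [ite_mul, zero_mul, Finset.sum_ite_mem, Finset.univ_inter, add_mul]
    rw [Finset.sum_add_distrib, ← Finset.mul_sum, h2, h3]
    simp only [hv]
    by_cases hSe : S = ∅
    · subst hSe
      rw [if_pos rfl, if_pos rfl, ← he, Gdiag]
      field_simp
      ring
    · rw [if_neg (fun h => hSe (congrArg Subtype.val h)), if_neg hSe]
      ring

theorem sum_mul_ite_subset_of_moments (d : ℕ) (μ : Finset ι → ℝ)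
    (h : ∀ S : Finset ι, S.card ≤ d → ∑ A, μ A * cubeChar S A = if S = ∅ then 1 else 0)
    (U : Finset ι) (hU : U.card ≤ d) :
    ∑ A, μ A * (if U ⊆ A then 1 else 0) = (1 / 2) ^ U.card := by
  simp_rw [ite_subset_eq_sum_cubeChar, Finset.mul_sum]
  rw [Finset.sum_comm]
  have : ∀ S ∈ U.powerset,
      ∑ A, μ A * ((1 / 2) ^ U.card * ((-1) ^ S.card * cubeChar S A)) =
        if S = ∅ then (1 / 2) ^ U.card else 0 := by
    intro S hS
    have h1 := h S ((Finset.card_le_card (Finset.mem_powerset.1 hS)).trans hU)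
    calc ∑ A, μ A * ((1 / 2) ^ U.card * ((-1) ^ S.card * cubeChar S A))
        = (1 / 2) ^ U.card * (-1) ^ S.card * ∑ A, μ A * cubeChar S A := by
          rw [Finset.mul_sum]; exact Finset.sum_congr rfl fun A _ => by ring
      _ = _ := by
          rw [h1]; split_ifs with hs
          · simp [hs]
          · simp
  rw [Finset.sum_congr rfl this]
  simp

/-- A modular affine form each of whose fibres carries a distribution with uniform moments up to
degree `d`. -/
theorem exists_affine_fiber_moments (d M : ℕ) [NeZero M]
    (hbound : 16 * (M : ℝ) ^ 2 *
      ((Finset.univ.filter fun S : Finset ι => S.card ≤ 2 * d).card : ℝ) ^ 3 ≤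
        2 ^ Fintype.card ι) :
    ∃ (w : ι → ZMod M) (w₀ : ZMod M), ∀ z, ∃ μ : Finset ι → ℝ, (∀ A, 0 ≤ μ A) ∧
      (∀ A, w₀ + ∑ i ∈ A, w i ≠ z → μ A = 0) ∧
      ∀ U : Finset ι, U.card ≤ d → ∑ A, μ A * (if U ⊆ A then 1 else 0) = (1 / 2) ^ U.card := by
  have hM : (0 : ℝ) < M := Nat.cast_pos.2 (Nat.pos_of_ne_zero (NeZero.ne M))
  set 𝒮 := Finset.univ.filter fun S : Finset ι => S.card ≤ 2 * d with h𝒮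
  set E : ℝ := (𝒮.card : ℝ) with hE
  set D : ℝ := ((Finset.univ.filter fun S : Finset ι => S.card ≤ d).card : ℝ) with hD
  have hDE : D ≤ E := by
    rw [hD, hE, Nat.cast_le]
    refine Finset.card_le_card fun S hS => ?_
    simp only [h𝒮, Finset.mem_filter, Finset.mem_univ, true_and] at hS ⊢
    omega
  have hD1 : 1 ≤ D := by
    rw [hD, Nat.one_le_cast]
    exact Finset.card_pos.2 ⟨∅, by simp⟩
  set W : ℝ := 2 ^ Fintype.card ι with hW
  have hW0 : 0 < W := by positivity
  obtain ⟨w, w₀, hw⟩ := exists_affine_small_discrepancy M 𝒮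
  refine ⟨w, w₀, fun z => ?_⟩
  set 𝒜 := Finset.univ.filter fun A : Finset ι => w₀ + ∑ i ∈ A, w i = z with h𝒜
  set τ := Real.sqrt (E * W) with hτ
  have hτ0 : 0 ≤ τ := Real.sqrt_nonneg _
  have hτ2 : τ ^ 2 = E * W := Real.sq_sqrt (by positivity)
  have key : ∀ S ∈ 𝒮, |∑ A ∈ 𝒜, cubeChar S A - (∑ A, cubeChar S A) / M| ≤ τ := by
    intro S hS
    apply Real.abs_le_sqrt
    refine le_of_eq_of_le ?_ (hw z S hS)
    congr 1
    rw [h𝒜, Finset.sum_filter, Finset.sum_div, ← Finset.sum_sub_distrib]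
    refine Finset.sum_congr rfl fun A _ => ?_
    split_ifs <;> ring
  have h3 : 4 * D * τ ≤ W / M := by
    rw [le_div_iff₀ hM]
    refine le_of_sq_le_sq ?_ hW0.le
    calc (4 * D * τ * M) ^ 2 = 16 * M ^ 2 * D ^ 2 * (τ ^ 2) := by ring
      _ ≤ 16 * M ^ 2 * E ^ 2 * (τ ^ 2) := by gcongr
      _ = (16 * M ^ 2 * E ^ 3) * W := by rw [hτ2]; ring
      _ ≤ W * W := by gcongr
      _ = W ^ 2 := by ring
  have hE0 : 0 < E := by linarith
  have hτpos : 0 < τ := Real.sqrt_pos.2 (by positivity)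
  have hcard : 3 * D * τ ≤ (𝒜.card : ℝ) := by
    have h := key ∅ (by simp [h𝒮])
    simp only [cubeChar_empty, Finset.sum_const, nsmul_eq_mul, mul_one, Finset.card_univ,
      Fintype.card_finset] at h
    have h' := (abs_le.1 h).1
    push_cast at h'
    rw [← hW] at h'
    nlinarith [mul_le_mul_of_nonneg_right hD1 hτ0]
  have hDτ : 0 < D * τ := by positivity
  obtain ⟨μ, h1, h2, h4⟩ := exists_distribution_of_sum_cubeChar_le d 𝒜 τ
    (by
      intro S hS hSd
      have h := key S (by simp [h𝒮, hSd])
      rwa [sum_cubeChar S hS, zero_div, sub_zero] at h)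
    (by
      have : (0 : ℝ) < 𝒜.card := by linarith
      exact_mod_cast this)
    (by linarith)
  exact ⟨μ, h1, fun A hA => h2 A (by simpa [h𝒜] using hA),
    sum_mul_ite_subset_of_moments d μ h4⟩

omit [DecidableEq ι] in
/-- The number of subsets of size at most `k` is at most `x ^ (-k) * (1 + x) ^ n` for `x ≤ 1`. -/
theorem card_filter_card_le_mul_pow_le (k : ℕ) {x : ℝ} (hx0 : 0 < x) (hx1 : x ≤ 1) :
    ((Finset.univ.filter fun S : Finset ι => S.card ≤ k).card : ℝ) * x ^ k ≤
      (1 + x) ^ Fintype.card ι := by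
  have h := Finset.prod_one_add (f := fun _ : ι => x) Finset.univ
  simp only [Finset.prod_const, Finset.card_univ, Finset.powerset_univ] at h
  rw [h, ← nsmul_eq_mul, ← Finset.sum_const]
  calc ∑ S ∈ Finset.univ.filter (fun S : Finset ι => S.card ≤ k), x ^ k
      ≤ ∑ S ∈ Finset.univ.filter (fun S : Finset ι => S.card ≤ k), x ^ S.card :=
        Finset.sum_le_sum fun S hS =>
          pow_le_pow_of_le_one hx0.le hx1 (Finset.mem_filter.1 hS).2
    _ ≤ ∑ S : Finset ι, x ^ S.card :=
        Finset.sum_le_sum_of_subset_of_nonneg (Finset.filter_subset _ _)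
          fun _ _ _ => by positivity

end Moments

/-! ### From polynomials on the cube to univariate polynomials -/

section Univariate

open Polynomial (natDegree)

variable {α β : Type*} [Fintype α] [DecidableEq α] [Fintype β] [DecidableEq β]

/-- The indicator vector of a pair of sets, as a point of `{0,1}^(α ⊕ β)`. -/
def sumPoint (A : Finset α) (B : Finset β) : α ⊕ β → ℝ :=
  Sum.elim (fun i => if i ∈ A then 1 else 0) (fun j => if j ∈ B then 1 else 0)

theorem prod_ite_mem_pow (A : Finset α) (f : α → ℕ) :
    ∏ i, (if i ∈ A then (1 : ℝ) else 0) ^ f i =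
      if (Finset.univ.filter fun i => f i ≠ 0) ⊆ A then 1 else 0 := by
  have : ∀ i ∈ Finset.univ, (if i ∈ A then (1 : ℝ) else 0) ^ f i =
      if (f i ≠ 0 → i ∈ A) then 1 else 0 := by
    intro i _
    by_cases h1 : i ∈ A <;> by_cases h2 : f i = 0 <;> simp [h1, h2]
  rw [Finset.prod_congr rfl this, Finset.prod_boole]
  congr 1
  simp [Finset.subset_iff]

omit [DecidableEq α] in
theorem card_filter_ne_zero_le_sum (f : α → ℕ) :
    (Finset.univ.filter fun i => f i ≠ 0).card ≤ ∑ i, f i := by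
  rw [Finset.card_filter]
  refine Finset.sum_le_sum fun i _ => ?_
  split_ifs with h <;> omega

theorem sum_powersetCard_ite_subset (T : Finset β) (k : ℕ) (hk : k ≤ Fintype.card β) :
    (∑ B ∈ Finset.powersetCard k (Finset.univ : Finset β), if T ⊆ B then (1 : ℝ) else 0) /
      (Fintype.card β).choose k =
      (∏ j ∈ Finset.range T.card, ((k : ℝ) - j)) / (Fintype.card β).descFactorial T.card := by
  set m := Fintype.card β
  have hT : T.card ≤ m := Finset.card_le_univ T
  have hc : ((m.choose k : ℕ) : ℝ) ≠ 0 := Nat.cast_ne_zero.2 (Nat.choose_pos hk).ne'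
  have hd : ((m.descFactorial T.card : ℕ) : ℝ) ≠ 0 := by
    rw [Nat.cast_ne_zero]
    intro h
    have := Nat.descFactorial_eq_zero_iff_lt.1 h
    omega
  rw [← descPochhammer_eval_eq_prod_range, descPochhammer_eval_eq_descFactorial, Finset.sum_boole,
    div_eq_div_iff hc hd]
  by_cases h : T.card ≤ k
  · rw [Finset.card_filter_powersetCard_subset _ _ _ (Finset.subset_univ T) h, Finset.card_univ]
    rw [Nat.descFactorial_eq_factorial_mul_choose, Nat.descFactorial_eq_factorial_mul_choose]
    have := Nat.choose_mul (n := m) h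
    norm_cast
    rw [mul_comm, mul_assoc, ← this]
    ring
  · rw [Nat.descFactorial_eq_zero_iff_lt.2 (not_le.1 h), Finset.filter_false_of_mem]
    · simp
    · intro B hB hTB
      have := Finset.card_le_card hTB
      rw [(Finset.mem_powersetCard.1 hB).2] at this
      exact h this

variable {Z : Set ℤ} {μ : ℤ → Finset α → ℝ} {d : ℕ}

theorem exists_polynomial_eq_moment
    (hμ : ∀ z ∈ Z, ∀ U : Finset α, U.card ≤ d →
      ∑ A, μ z A * (if U ⊆ A then 1 else 0) = (1 / 2) ^ U.card)
    (e : ℕ) (he : e ≤ d) (G : MvPolynomial (Option α) ℝ) (hG : G.totalDegree ≤ e) :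
    ∃ P : Polynomial ℝ, P.natDegree ≤ e ∧ ∀ z ∈ Z, P.eval (z : ℝ) =
      ∑ A, μ z A * MvPolynomial.eval
        (fun o : Option α => o.elim (z : ℝ) fun i => if i ∈ A then 1 else 0) G := by
  have hs : ∀ s ∈ G.support, s none + ∑ i, s (some i) ≤ e := by
    intro s hs
    have h := (MvPolynomial.le_totalDegree hs).trans hG
    rwa [Finsupp.sum_fintype _ _ (fun _ => rfl), Fintype.sum_option] at h
  refine ⟨∑ s ∈ G.support, Polynomial.C (G.coeff s *
    (1 / 2) ^ (Finset.univ.filter fun i => s (some i) ≠ 0).card) * Polynomial.X ^ s none, ?_, ?_⟩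
  · refine Polynomial.natDegree_sum_le_of_forall_le _ _ fun s h => ?_
    exact (Polynomial.natDegree_C_mul_X_pow_le _ _).trans (by have := hs s h; omega)
  · intro z hz
    simp_rw [MvPolynomial.eval_eq', Fintype.prod_option, Option.elim_none, Option.elim_some,
      prod_ite_mem_pow, Polynomial.eval_finsetSum, Finset.mul_sum]
    rw [Finset.sum_comm]
    refine Finset.sum_congr rfl fun s h => ?_
    have h1 := card_filter_ne_zero_le_sum fun i => s (some i)
    have h2 := hs s h
    rw [Polynomial.eval_mul, Polynomial.eval_C, Polynomial.eval_pow, Polynomial.eval_X,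
      ← hμ z hz _ (by omega), Finset.mul_sum, Finset.sum_mul]
    exact Finset.sum_congr rfl fun A _ => by ring

/-- The average of `p` over `x` distributed according to `ν` and a uniformly random `y` with
`k x` ones. -/
noncomputable def slicedMean (ν : Finset α → ℝ) (k : Finset α → ℕ)
    (p : MvPolynomial (α ⊕ β) ℝ) : ℝ :=
  ∑ A, ν A * ((∑ B ∈ Finset.powersetCard (k A) (Finset.univ : Finset β),
    MvPolynomial.eval (sumPoint A B) p) / (Fintype.card β).choose (k A))

theorem slicedMean_le_slicedMean {ν : Finset α → ℝ} (hν : ∀ A, 0 ≤ ν A) (k : Finset α → ℕ)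
    (p q : MvPolynomial (α ⊕ β) ℝ)
    (h : ∀ A, ν A ≠ 0 → ∀ B : Finset β, B.card = k A →
      MvPolynomial.eval (sumPoint A B) p ≤ MvPolynomial.eval (sumPoint A B) q) :
    slicedMean ν k p ≤ slicedMean ν k q := by
  refine Finset.sum_le_sum fun A _ => ?_
  by_cases hA : ν A = 0
  · simp [hA]
  · refine mul_le_mul_of_nonneg_left ?_ (hν A)
    refine div_le_div_of_nonneg_right ?_ (Nat.cast_nonneg _)
    exact Finset.sum_le_sum fun B hB => h A hA B (Finset.mem_powersetCard.1 hB).2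

theorem slicedMean_pos {ν : Finset α → ℝ} (hν : ∀ A, 0 ≤ ν A) (k : Finset α → ℕ)
    (hsum : ∑ A, ν A = 1) (hk : ∀ A, ν A ≠ 0 → k A ≤ Fintype.card β)
    (q : MvPolynomial (α ⊕ β) ℝ)
    (h : ∀ A, ν A ≠ 0 → ∀ B : Finset β, B.card = k A → 0 < MvPolynomial.eval (sumPoint A B) q) :
    0 < slicedMean ν k q := by
  have hpos : ∀ A, ν A ≠ 0 → 0 < ν A * ((∑ B ∈ Finset.powersetCard (k A)
      (Finset.univ : Finset β), MvPolynomial.eval (sumPoint A B) q) /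
        (Fintype.card β).choose (k A)) := by
    intro A hA
    refine mul_pos (lt_of_le_of_ne (hν A) hA.symm) (div_pos ?_ ?_)
    · exact Finset.sum_pos (fun B hB => h A hA B (Finset.mem_powersetCard.1 hB).2)
        (Finset.powersetCard_nonempty.2 (by simpa using hk A hA))
    · exact Nat.cast_pos.2 (Nat.choose_pos (hk A hA))
  obtain ⟨A, -, hA⟩ := Finset.exists_ne_zero_of_sum_ne_zero (hsum.trans_ne one_ne_zero)
  refine Finset.sum_pos' (fun B _ => ?_) ⟨A, Finset.mem_univ A, hpos A hA⟩
  by_cases hB : ν B = 0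
  · simp [hB]
  · exact (hpos B hB).le

theorem slicedMean_neg (ν : Finset α → ℝ) (k : Finset α → ℕ) (p : MvPolynomial (α ⊕ β) ℝ) :
    slicedMean ν k (-p) = -slicedMean ν k p := by
  simp [slicedMean, Finset.sum_neg_distrib, neg_div]

theorem slicedMean_C_mul (ν : Finset α → ℝ) (k : Finset α → ℕ) (c : ℝ)
    (p : MvPolynomial (α ⊕ β) ℝ) :
    slicedMean ν k (MvPolynomial.C c * p) = c * slicedMean ν k p := by
  simp only [slicedMean, map_mul, MvPolynomial.eval_C, ← Finset.mul_sum]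
  rw [Finset.mul_sum]
  exact Finset.sum_congr rfl fun A _ => by ring

/-- If the law `μ z` of `x` is supported where `w₀ + w · x - z` is `M` times the integer
`k z x`, and has uniform moments, then the average of a polynomial of degree `d` is a univariate
polynomial of degree `d` in `z`. -/
theorem exists_polynomial_eq_slicedMean
    (hμ : ∀ z ∈ Z, ∀ U : Finset α, U.card ≤ d →
      ∑ A, μ z A * (if U ⊆ A then 1 else 0) = (1 / 2) ^ U.card)
    (w : α → ℤ) (w₀ : ℤ) (M : ℕ) (hM : 0 < M) (k : ℤ → Finset α → ℕ)
    (hk : ∀ z ∈ Z, ∀ A, μ z A ≠ 0 → k z A ≤ Fintype.card β ∧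
      w₀ + ∑ i ∈ A, w i - z = M * (k z A : ℤ))
    (e : ℕ) (he : e ≤ d) (p : MvPolynomial (α ⊕ β) ℝ) (hp : p.totalDegree ≤ e) :
    ∃ P : Polynomial ℝ, P.natDegree ≤ e ∧
      ∀ z ∈ Z, P.eval (z : ℝ) = slicedMean (μ z) (k z) p := by
  have hM0 : (M : ℝ) ≠ 0 := Nat.cast_ne_zero.2 hM.ne'
  have mono : ∀ (U : Finset α) (T : Finset β), U.card + T.card ≤ e →
      ∃ P : Polynomial ℝ, P.natDegree ≤ e ∧ ∀ z ∈ Z, P.eval (z : ℝ) =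
        ∑ A, μ z A * ((∑ B ∈ Finset.powersetCard (k z A) (Finset.univ : Finset β),
          (if U ⊆ A then 1 else 0) * (if T ⊆ B then 1 else 0)) /
            (Fintype.card β).choose (k z A)) := by
    intro U T hUT
    set K : MvPolynomial (Option α) ℝ := MvPolynomial.C (M : ℝ)⁻¹ * (MvPolynomial.C (w₀ : ℝ) +
      ∑ i, MvPolynomial.C (w i : ℝ) * MvPolynomial.X (some i) - MvPolynomial.X none) with hK
    have hKd : ∀ j : ℕ, (K - MvPolynomial.C (j : ℝ)).totalDegree ≤ 1 := by
      intro j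
      refine (MvPolynomial.totalDegree_sub_C_le _ _).trans ?_
      refine (MvPolynomial.totalDegree_mul _ _).trans ?_
      rw [MvPolynomial.totalDegree_C, zero_add]
      refine (MvPolynomial.totalDegree_sub _ _).trans (max_le ?_ ?_)
      · refine (MvPolynomial.totalDegree_add _ _).trans (max_le
          (by rw [MvPolynomial.totalDegree_C]; exact Nat.zero_le _) ?_)
        refine MvPolynomial.totalDegree_finsetSum_le fun i _ => ?_
        refine (MvPolynomial.totalDegree_mul _ _).trans ?_
        rw [MvPolynomial.totalDegree_C, MvPolynomial.totalDegree_X]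
      · simp
    set G : MvPolynomial (Option α) ℝ :=
      MvPolynomial.C ((((Fintype.card β).descFactorial T.card : ℕ) : ℝ)⁻¹) *
        ((∏ i ∈ U, MvPolynomial.X (some i)) *
          ∏ j ∈ Finset.range T.card, (K - MvPolynomial.C (j : ℝ))) with hG
    have hGd : G.totalDegree ≤ e := by
      refine (MvPolynomial.totalDegree_mul _ _).trans ?_
      rw [MvPolynomial.totalDegree_C, zero_add]
      refine (MvPolynomial.totalDegree_mul _ _).trans (le_trans (add_le_add ?_ ?_) hUT)
      · refine (MvPolynomial.totalDegree_finsetProd _ _).trans ?_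
        simp
      · refine (MvPolynomial.totalDegree_finsetProd _ _).trans ?_
        exact (Finset.sum_le_card_nsmul _ _ 1 fun j _ => hKd j).trans (by simp)
    obtain ⟨P, hP, hPe⟩ := exists_polynomial_eq_moment hμ e he G hGd
    refine ⟨P, hP, fun z hz => ?_⟩
    rw [hPe z hz]
    refine Finset.sum_congr rfl fun A _ => ?_
    by_cases hA : μ z A = 0
    · simp [hA]
    · obtain ⟨hk1, hk2⟩ := hk z hz A hA
      congr 1
      rw [← Finset.mul_sum, mul_div_assoc, sum_powersetCard_ite_subset T _ hk1]
      have hKe : MvPolynomial.eval (fun o : Option α => o.elim (z : ℝ)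
          fun i => if i ∈ A then 1 else 0) K = k z A := by
        have h3 : (w₀ : ℝ) + ∑ i ∈ A, (w i : ℝ) - z = M * (k z A : ℝ) := by exact_mod_cast hk2
        simp only [hK, map_mul, map_sub, map_add, map_sum, MvPolynomial.eval_C,
          MvPolynomial.eval_X, Option.elim_none, Option.elim_some, mul_ite, mul_one, mul_zero,
          Finset.sum_ite_mem, Finset.univ_inter]
        rw [h3]
        field_simp
      simp only [hG, map_mul, map_prod, map_sub, MvPolynomial.eval_C, MvPolynomial.eval_X,
        Option.elim_some, hKe]
      rw [Finset.prod_boole]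
      have : (∀ i ∈ U, i ∈ A) ↔ U ⊆ A := Iff.rfl
      simp only [this]
      ring
  have hs : ∀ s ∈ p.support, (Finset.univ.filter fun i => s (Sum.inl i) ≠ 0).card +
      (Finset.univ.filter fun j => s (Sum.inr j) ≠ 0).card ≤ e := by
    intro s hs
    have h := (MvPolynomial.le_totalDegree hs).trans hp
    rw [Finsupp.sum_fintype _ _ (fun _ => rfl), Fintype.sum_sum_type] at h
    exact (add_le_add (card_filter_ne_zero_le_sum fun i => s (Sum.inl i))
      (card_filter_ne_zero_le_sum fun j => s (Sum.inr j))).trans h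
  have hs' : ∀ s, ∃ P : Polynomial ℝ, s ∈ p.support → P.natDegree ≤ e ∧ ∀ z ∈ Z,
      P.eval (z : ℝ) =
        ∑ A, μ z A * ((∑ B ∈ Finset.powersetCard (k z A) (Finset.univ : Finset β),
          (if (Finset.univ.filter fun i => s (Sum.inl i) ≠ 0) ⊆ A then 1 else 0) *
          (if (Finset.univ.filter fun j => s (Sum.inr j) ≠ 0) ⊆ B then 1 else 0)) /
            (Fintype.card β).choose (k z A)) := by
    intro s
    by_cases h : s ∈ p.support
    · obtain ⟨P, hP⟩ := mono _ _ (hs s h)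
      exact ⟨P, fun _ => hP⟩
    · exact ⟨0, fun h' => absurd h' h⟩
  choose P hP using hs'
  refine ⟨∑ s ∈ p.support, Polynomial.C (p.coeff s) * P s, ?_, ?_⟩
  · exact Polynomial.natDegree_sum_le_of_forall_le _ _ fun s h =>
      (Polynomial.natDegree_C_mul_le _ _).trans (hP s h).1
  · intro z hz
    simp only [slicedMean, sumPoint]
    simp_rw [MvPolynomial.eval_eq', Fintype.prod_sum_type, Sum.elim_inl, Sum.elim_inr,
      prod_ite_mem_pow, Polynomial.eval_finsetSum]
    have : ∀ A : Finset α, μ z A * ((∑ B ∈ Finset.powersetCard (k z A) (Finset.univ : Finset β),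
        ∑ s ∈ p.support, p.coeff s *
          ((if (Finset.univ.filter fun i => s (Sum.inl i) ≠ 0) ⊆ A then 1 else 0) *
          (if (Finset.univ.filter fun j => s (Sum.inr j) ≠ 0) ⊆ B then 1 else 0))) /
            (Fintype.card β).choose (k z A)) =
        ∑ s ∈ p.support, p.coeff s * (μ z A *
          ((∑ B ∈ Finset.powersetCard (k z A) (Finset.univ : Finset β),
          (if (Finset.univ.filter fun i => s (Sum.inl i) ≠ 0) ⊆ A then 1 else 0) *
          (if (Finset.univ.filter fun j => s (Sum.inr j) ≠ 0) ⊆ B then 1 else 0)) /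
            (Fintype.card β).choose (k z A))) := by
      intro A
      rw [Finset.sum_comm, Finset.sum_div, Finset.mul_sum]
      refine Finset.sum_congr rfl fun s _ => ?_
      rw [← Finset.mul_sum]
      ring
    rw [Finset.sum_congr rfl fun A _ => this A, Finset.sum_comm]
    refine Finset.sum_congr rfl fun s h => ?_
    rw [Polynomial.eval_mul, Polynomial.eval_C, (hP s h).2 z hz, Finset.mul_sum]

end Univariate

/-! ### An affine form whose sign is hard to approximate -/

section HardForm

variable {α β : Type*} [Fintype α] [DecidableEq α] [Fintype β] [DecidableEq β]

/-- There is an affine form with integer coefficients of size `2 ^ k` whose sign on the cube cannot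
be approximated by rational functions of degree `d` with a margin above `8 / 2 ^ s`. -/
theorem exists_hard_affine_form (D k : ℕ) (hk : 1 ≤ k)
    (hβ : Fintype.card α + 2 ≤ Fintype.card β)
    (hbound : 16 * ((2 ^ k : ℕ) : ℝ) ^ 2 *
      ((Finset.univ.filter fun S : Finset α => S.card ≤ 2 * D).card : ℝ) ^ 3 ≤
        2 ^ Fintype.card α) :
    ∃ (w : α → ℤ) (w₀ : ℤ),
      (∀ (A : Finset α) (B : Finset β),
        |w₀ + ∑ i ∈ A, w i - 2 ^ k * B.card| ≤ Fintype.card β * 2 ^ k) ∧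
      ∀ (d s : ℕ) (δ : ℝ) (p q : MvPolynomial (α ⊕ β) ℝ), d ≤ D → 1 ≤ s →
        s * (2 * d + 2) + 1 ≤ k → 0 < δ → p.totalDegree ≤ d → q.totalDegree ≤ d →
        (∀ A B, 0 < MvPolynomial.eval (sumPoint A B) q) →
        (∀ A B, 0 ≤ w₀ + ∑ i ∈ A, w i - 2 ^ k * B.card →
          δ * MvPolynomial.eval (sumPoint A B) q ≤ MvPolynomial.eval (sumPoint A B) p ∧
          MvPolynomial.eval (sumPoint A B) p ≤ 2 * MvPolynomial.eval (sumPoint A B) q) →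
        (∀ A B, w₀ + ∑ i ∈ A, w i - 2 ^ k * B.card < 0 →
          δ * MvPolynomial.eval (sumPoint A B) q ≤ -MvPolynomial.eval (sumPoint A B) p ∧
          -MvPolynomial.eval (sumPoint A B) p ≤ 2 * MvPolynomial.eval (sumPoint A B) q) →
        δ * 2 ^ s ≤ 8 := by
  set M : ℕ := 2 ^ k with hM
  have hM0 : 0 < M := by positivity
  have : NeZero M := ⟨hM0.ne'⟩
  have hMZ : (2 : ℤ) ^ k = (M : ℤ) := by rw [hM]; push_cast; rfl
  rw [hMZ]
  obtain ⟨v, v₀, hv⟩ := exists_affine_fiber_moments (ι := α) D M hbound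
  choose ν hν0 hνs hνm using hv
  set w : α → ℤ := fun i => ((v i).val : ℤ) with hw
  set w₀ : ℤ := (v₀.val : ℤ) + M with hw₀
  have hsum0 : ∀ A : Finset α, 0 ≤ ∑ i ∈ A, w i := fun A =>
    Finset.sum_nonneg fun i _ => Int.natCast_nonneg _
  have hsum1 : ∀ A : Finset α, ∑ i ∈ A, w i ≤ Fintype.card α * M := by
    intro A
    calc ∑ i ∈ A, w i ≤ ∑ i ∈ A, (M : ℤ) :=
          Finset.sum_le_sum fun i _ => Int.ofNat_le.2 (ZMod.val_lt (v i)).le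
      _ = (A.card : ℤ) * M := by rw [Finset.sum_const, nsmul_eq_mul]
      _ ≤ _ := by gcongr; exact Finset.card_le_univ A
  have hv0 : (v₀.val : ℤ) < M := by exact_mod_cast ZMod.val_lt v₀
  have hv0' : 0 ≤ (v₀.val : ℤ) := Int.natCast_nonneg _
  have hMpos : (0 : ℤ) < M := by exact_mod_cast hM0
  have hβ' : ((Fintype.card α : ℤ) + 2) * M ≤ Fintype.card β * M := by
    gcongr; exact_mod_cast hβ
  refine ⟨w, w₀, fun A B => ?_, ?_⟩
  · have h1 := hsum0 A
    have h2 := hsum1 A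
    have h3 : (M : ℤ) * B.card ≤ Fintype.card β * M := by
      rw [mul_comm]; gcongr; exact Finset.card_le_univ B
    have h4 : 0 ≤ (M : ℤ) * B.card := by positivity
    rw [abs_le]
    constructor <;> linarith
  intro d s δ p q hd hs hsk hδ hp hq hqpos hpos hneg
  set Z : Set ℤ := {z | |z| ≤ 2 ^ (k - 1)} with hZ
  set μ : ℤ → Finset α → ℝ := fun z => ν (z : ZMod M) with hμ
  set κ : ℤ → Finset α → ℕ := fun z A => ((w₀ + ∑ i ∈ A, w i - z) / M).toNat with hκ
  have hhalf : (2 : ℤ) ^ (k - 1) * 2 = M := by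
    rw [← pow_succ, ← hMZ]; congr 1; omega
  have hκ' : ∀ z ∈ Z, ∀ A, μ z A ≠ 0 → κ z A ≤ Fintype.card β ∧
      w₀ + ∑ i ∈ A, w i - z = M * (κ z A : ℤ) := by
    intro z hz A hA
    have hz' := abs_le.1 (show |z| ≤ 2 ^ (k - 1) from hz)
    have hdvd : (M : ℤ) ∣ w₀ + ∑ i ∈ A, w i - z := by
      rw [← ZMod.intCast_zmod_eq_zero_iff_dvd]
      by_contra hne
      refine hA (hνs _ A fun h => hne ?_)
      simp only [hw₀, hw]
      push_cast
      rw [ZMod.natCast_zmod_val, ZMod.natCast_self, add_zero, ← h]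
      simp
    obtain ⟨c, hc⟩ := hdvd
    have h1 := hsum0 A
    have h2 := hsum1 A
    have hc0 : 0 ≤ c := by
      by_contra! hcon
      have : (M : ℤ) * c < 0 := mul_neg_of_pos_of_neg hMpos hcon
      linarith
    have hκc : κ z A = c.toNat := by
      simp only [hκ]; rw [hc, Int.mul_ediv_cancel_left _ hMpos.ne']
    have hκc' : (κ z A : ℤ) = c := by rw [hκc]; exact Int.toNat_of_nonneg hc0
    refine ⟨?_, by rw [hκc', hc]⟩
    have : (M : ℤ) * c < M * (Fintype.card β + 1) := by linarith
    have := lt_of_mul_lt_mul_left this hMpos.le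
    omega
  have hform : ∀ z ∈ Z, ∀ A, μ z A ≠ 0 → ∀ B : Finset β, B.card = κ z A →
      w₀ + ∑ i ∈ A, w i - M * B.card = z := by
    intro z hz A hA B hB
    have := (hκ' z hz A hA).2
    rw [hB]; linarith
  have hmom : ∀ z ∈ Z, ∀ U : Finset α, U.card ≤ D →
      ∑ A, μ z A * (if U ⊆ A then 1 else 0) = (1 / 2) ^ U.card := fun z _ => hνm z
  have hmass : ∀ z, ∑ A, μ z A = 1 := by
    intro z
    have := hνm z ∅ (by simp)
    simpa using this
  obtain ⟨P, hP, hPe⟩ := exists_polynomial_eq_slicedMean hmom w w₀ M hM0 κ hκ' d hd p hp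
  obtain ⟨Q, hQ, hQe⟩ := exists_polynomial_eq_slicedMean hmom w w₀ M hM0 κ hκ' d hd q hq
  have hQpos : ∀ z ∈ Z, 0 < Q.eval (z : ℝ) := by
    intro z hz
    rw [hQe z hz]
    exact slicedMean_pos (hν0 _) _ (hmass z) (fun A hA => (hκ' z hz A hA).1) q
      fun A _ B _ => hqpos A B
  have hPpos : ∀ z ∈ Z, 0 ≤ z → δ * Q.eval (z : ℝ) ≤ P.eval (z : ℝ) ∧
      P.eval (z : ℝ) ≤ 2 * Q.eval (z : ℝ) := by
    intro z hz hz0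
    rw [hQe z hz, hPe z hz, ← slicedMean_C_mul, ← slicedMean_C_mul]
    constructor <;> refine slicedMean_le_slicedMean (hν0 _) _ _ _ fun A hA B hB => ?_ <;>
      rw [map_mul, MvPolynomial.eval_C]
    · exact (hpos A B (by rw [hform z hz A hA B hB]; exact hz0)).1
    · exact (hpos A B (by rw [hform z hz A hA B hB]; exact hz0)).2
  have hPneg : ∀ z ∈ Z, z < 0 → δ * Q.eval (z : ℝ) ≤ -P.eval (z : ℝ) ∧
      -P.eval (z : ℝ) ≤ 2 * Q.eval (z : ℝ) := by
    intro z hz hz0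
    rw [hQe z hz, hPe z hz, ← slicedMean_C_mul, ← slicedMean_C_mul, ← slicedMean_neg]
    constructor <;> refine slicedMean_le_slicedMean (hν0 _) _ _ _ fun A hA B hB => ?_ <;>
      rw [map_mul, map_neg, MvPolynomial.eval_C]
    · exact (hneg A B (by rw [hform z hz A hA B hB]; exact hz0)).1
    · exact (hneg A B (by rw [hform z hz A hA B hB]; exact hz0)).2
  have hmem : ∀ i ≤ 2 * d + 2, ((2 : ℤ) ^ s) ^ i ∈ Z ∧ -((2 : ℤ) ^ s) ^ i ∈ Z := by
    intro i hi
    have : |((2 : ℤ) ^ s) ^ i| ≤ 2 ^ (k - 1) := by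
      rw [abs_of_pos (by positivity), ← pow_mul]
      refine pow_le_pow_right₀ (by norm_num) ?_
      have := Nat.mul_le_mul_left s hi
      omega
    exact ⟨this, by rw [hZ, Set.mem_ofPred_eq, abs_neg]; exact this⟩
  refine P.margin_mul_le_of_geometric Q d hP hQ (one_lt_pow₀ (by norm_num) (by omega)) hδ ?_ ?_
  · intro i hi
    have h1 := (hmem i hi).1
    have e : ((((2 : ℤ) ^ s) ^ i : ℤ) : ℝ) = ((2 : ℝ) ^ s) ^ i := by push_cast; rfl
    rw [← e]
    exact ⟨hQpos _ h1, hPpos _ h1 (by positivity)⟩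
  · intro i hi
    have h1 := (hmem i hi).2
    have e : ((-((2 : ℤ) ^ s) ^ i : ℤ) : ℝ) = -((2 : ℝ) ^ s) ^ i := by push_cast; rfl
    rw [← e]
    exact ⟨hQpos _ h1, hPneg _ h1 (neg_neg_of_pos (by positivity))⟩

end HardForm

/-! ### Rational approximation of halfspaces with bounded weights -/

theorem exists_pow_le_le_pow_succ {S z : ℝ} (hz : 1 ≤ z) (k : ℕ) (hk : 1 ≤ k) (hzk : z ≤ S ^ k) :
    ∃ i < k, S ^ i ≤ z ∧ z ≤ S ^ (i + 1) := by
  induction k, hk using Nat.le_induction with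
  | base => exact ⟨0, by norm_num, by simpa using hz, by simpa using hzk⟩
  | succ k _ ih =>
    rcases le_total z (S ^ k) with h | h
    · obtain ⟨i, hi, h'⟩ := ih h
      exact ⟨i, by omega, h'⟩
    · exact ⟨k, by omega, h, hzk⟩

theorem abs_prod_sub_mul_le_prod_add_mul {S z : ℝ} (hS : 1 ≤ S) (hz : 1 ≤ z) (k : ℕ) (hk : 1 ≤ k)
    (hzk : z ≤ S ^ k) :
    |∏ i ∈ Finset.range k, (z - S ^ (i + 1))| * (S + 1) ≤
      (∏ i ∈ Finset.range k, (z + S ^ (i + 1))) * (S - 1) := by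
  obtain ⟨i, hi, h1, h2⟩ := exists_pow_le_le_pow_succ hz k hk hzk
  have hi' := Finset.mem_range.2 hi
  have hS0 : 0 < S := by linarith
  rw [← Finset.mul_prod_erase _ _ hi', ← Finset.mul_prod_erase (Finset.range k)
    (fun i => z + S ^ (i + 1)) hi', abs_mul, Finset.abs_prod]
  have h3 : ∏ j ∈ (Finset.range k).erase i, |z - S ^ (j + 1)| ≤
      ∏ j ∈ (Finset.range k).erase i, (z + S ^ (j + 1)) := by
    refine Finset.prod_le_prod (fun j _ => abs_nonneg _) fun j _ => ?_
    have : 0 < S ^ (j + 1) := by positivity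
    rw [abs_le]; constructor <;> linarith
  have h4 : |z - S ^ (i + 1)| * (S + 1) ≤ (z + S ^ (i + 1)) * (S - 1) := by
    rw [abs_of_nonpos (by linarith)]
    have : S ^ (i + 1) ≤ z * S := by rw [pow_succ]; gcongr
    nlinarith
  have h5 : 0 ≤ ∏ j ∈ (Finset.range k).erase i, |z - S ^ (j + 1)| :=
    Finset.prod_nonneg fun j _ => abs_nonneg _
  have h6 : 0 ≤ (z + S ^ (i + 1)) * (S - 1) := by
    have : 0 < S ^ (i + 1) := by positivity
    exact mul_nonneg (by linarith) (by linarith)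
  calc _ = (|z - S ^ (i + 1)| * (S + 1)) * ∏ j ∈ (Finset.range k).erase i, |z - S ^ (j + 1)| := by
        ring
    _ ≤ ((z + S ^ (i + 1)) * (S - 1)) * ∏ j ∈ (Finset.range k).erase i, (z + S ^ (j + 1)) :=
        mul_le_mul h4 h3 h5 h6
    _ = _ := by ring

theorem abs_one_sub_sq_div_le {S A B : ℝ} (hS : 1 ≤ S) (hA : 0 < A)
    (h : |B| * (S + 1) ≤ A * (S - 1)) :
    |1 - (A * A - B * B) / (A * A + B * B)| ≤ 1 - 1 / S := by
  have hS0 : 0 < S := by linarith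
  have hq : 0 < A * A + B * B := by nlinarith [mul_self_nonneg B]
  have e : 1 - (A * A - B * B) / (A * A + B * B) = 2 * (B * B) / (A * A + B * B) := by
    field_simp; ring
  have e2 : 1 - 1 / S = (S - 1) / S := by field_simp
  rw [e, e2, abs_of_nonneg (div_nonneg (by nlinarith [mul_self_nonneg B]) hq.le),
    div_le_div_iff₀ hq hS0]
  have h1 : (B * B) * (S + 1) ^ 2 ≤ (A * A) * (S - 1) ^ 2 := by
    have := mul_self_le_mul_self (by positivity) h
    rw [← abs_mul_abs_self B]
    linarith
  have h2 : (B * B) * (S + 1) ≤ (A * A) * (S - 1) := by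
    refine le_of_mul_le_mul_right ?_ (show 0 < S + 1 by linarith)
    have : 0 ≤ (A * A) * (S - 1) := mul_nonneg (by positivity) (by linarith)
    nlinarith
  linarith

theorem RPlus_le_ofReal {n : ℕ} {X : Set (Fin n → ℝ)} (f : X → ℝ) (d : ℕ) (ε : ℝ)
    (p q : MvPolynomial (Fin n) ℝ) (hp : p.totalDegree ≤ d) (hq : q.totalDegree ≤ d)
    (hpos : ∀ x ∈ X, 0 < MvPolynomial.eval x q)
    (h : ∀ x : X, |f x - MvPolynomial.eval x.1 p / MvPolynomial.eval x.1 q| ≤ ε) :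
    RPlus f d ≤ ENNReal.ofReal ε :=
  iInf_le_of_le p <| iInf_le_of_le q <| iInf_le_of_le ⟨hp, hq, hpos⟩ <|
    iSup_le fun x => ENNReal.ofReal_le_ofReal (h x)

/-- The sign of an affine form with values in `[-e ^ K, -1] ∪ [1, e ^ K]` has approximations of
degree `d` with error at most `1 - exp (-3 K / d)`. -/
theorem RPlus_sign_le {n : ℕ} {X : Set (Fin n → ℝ)} (f : X → ℝ) (w : Fin n → ℝ) (θ : ℝ)
    (hf : ∀ x : X, f x = Real.sign (∑ i, w i * x.1 i - θ)) {K : ℝ} (hK : 0 ≤ K)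
    (hlo : ∀ x : X, 1 ≤ |∑ i, w i * x.1 i - θ|)
    (hhi : ∀ x : X, |∑ i, w i * x.1 i - θ| ≤ Real.exp K) (d : ℕ) (hd : 1 ≤ d) :
    RPlus f d ≤ ENNReal.ofReal (1 - Real.exp (-(3 * K / d))) := by
  set L : MvPolynomial (Fin n) ℝ :=
    ∑ i, MvPolynomial.C (w i) * MvPolynomial.X i - MvPolynomial.C θ with hL
  have evL : ∀ x : Fin n → ℝ, MvPolynomial.eval x L = ∑ i, w i * x i - θ := by
    intro x; simp [hL]
  have degL : L.totalDegree ≤ 1 := by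
    refine (MvPolynomial.totalDegree_sub_C_le _ _).trans ?_
    refine MvPolynomial.totalDegree_finsetSum_le fun i _ => ?_
    refine (MvPolynomial.totalDegree_mul _ _).trans ?_
    rw [MvPolynomial.totalDegree_C, MvPolynomial.totalDegree_X]
  rcases Nat.lt_or_ge d 2 with h2 | h2
  · obtain rfl : d = 1 := by omega
    have hE := Real.exp_pos K
    refine RPlus_le_ofReal f 1 _ (MvPolynomial.C (Real.exp K)⁻¹ * L) 1 ?_ ?_ ?_ ?_
    · refine (MvPolynomial.totalDegree_mul _ _).trans ?_
      rw [MvPolynomial.totalDegree_C]; omega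
    · simp
    · simp
    · intro x
      rw [hf, map_mul, MvPolynomial.eval_C, evL, map_one, div_one]
      have h1 := hlo x
      have h3 := hhi x
      set z := ∑ i, w i * x.1 i - θ
      have h4 : Real.exp (-(3 * K / (1 : ℕ))) ≤ (Real.exp K)⁻¹ := by
        rw [← Real.exp_neg]
        refine Real.exp_le_exp.2 ?_
        push_cast; linarith
      have h5 : (Real.exp K)⁻¹ ≤ (Real.exp K)⁻¹ * |z| :=
        le_mul_of_one_le_right (by positivity) h1
      have h6 : (Real.exp K)⁻¹ * |z| ≤ 1 := by
        rw [inv_mul_le_iff₀ hE, mul_one]; exact h3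
      rcases lt_trichotomy z 0 with hz | hz | hz
      · rw [Real.sign_of_neg hz, abs_le]
        rw [abs_of_neg hz] at h5 h6
        constructor <;> linarith
      · rw [hz, abs_zero] at h1; linarith
      · rw [Real.sign_of_pos hz, abs_le]
        rw [abs_of_pos hz] at h5 h6
        constructor <;> linarith
  · set k := d / 2 with hk
    have hk1 : 1 ≤ k := by omega
    have hk0 : (0 : ℝ) < k := by exact_mod_cast hk1
    set S := Real.exp (K / k) with hS
    have hS1 : 1 ≤ S := Real.one_le_exp (by positivity)
    have hSk : S ^ k = Real.exp K := by
      rw [hS, ← Real.exp_nat_mul]; congr 1; field_simp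
    have hSd : 1 - 1 / S ≤ 1 - Real.exp (-(3 * K / d)) := by
      rw [one_div, hS, ← Real.exp_neg]
      have : K / k ≤ 3 * K / d := by
        have hd0 : (0 : ℝ) < d := by exact_mod_cast hd
        rw [div_le_div_iff₀ hk0 hd0]
        have : (d : ℝ) ≤ 3 * k := by
          have : d ≤ 3 * k := by omega
          exact_mod_cast this
        nlinarith
      have := Real.exp_le_exp.2 (neg_le_neg this)
      linarith
    set A : MvPolynomial (Fin n) ℝ :=
      ∏ i ∈ Finset.range k, (L + MvPolynomial.C (S ^ (i + 1))) with hA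
    set B : MvPolynomial (Fin n) ℝ :=
      ∏ i ∈ Finset.range k, (L - MvPolynomial.C (S ^ (i + 1))) with hB
    have evA : ∀ x, MvPolynomial.eval x A =
        ∏ i ∈ Finset.range k, ((∑ j, w j * x j - θ) + S ^ (i + 1)) := by
      intro x; rw [hA, map_prod]
      exact Finset.prod_congr rfl fun i _ => by rw [map_add, evL, MvPolynomial.eval_C]
    have evB : ∀ x, MvPolynomial.eval x B =
        ∏ i ∈ Finset.range k, ((∑ j, w j * x j - θ) - S ^ (i + 1)) := by
      intro x; rw [hB, map_prod]
      exact Finset.prod_congr rfl fun i _ => by rw [map_sub, evL, MvPolynomial.eval_C]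
    have degA : A.totalDegree ≤ k := by
      refine (MvPolynomial.totalDegree_finsetProd _ _).trans ?_
      refine (Finset.sum_le_card_nsmul _ _ 1 fun j _ => ?_).trans (by simp)
      exact (MvPolynomial.totalDegree_add _ _).trans
        (max_le degL (by rw [MvPolynomial.totalDegree_C]; exact Nat.zero_le _))
    have degB : B.totalDegree ≤ k := by
      refine (MvPolynomial.totalDegree_finsetProd _ _).trans ?_
      refine (Finset.sum_le_card_nsmul _ _ 1 fun j _ => ?_).trans (by simp)
      exact (MvPolynomial.totalDegree_sub_C_le _ _).trans degL
    have degAA : (A * A).totalDegree ≤ d := (MvPolynomial.totalDegree_mul _ _).trans (by omega)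
    have degBB : (B * B).totalDegree ≤ d := (MvPolynomial.totalDegree_mul _ _).trans (by omega)
    have cases : ∀ x : X, (f x = 1 ∧ 0 < MvPolynomial.eval x.1 A ∧
        |MvPolynomial.eval x.1 B| * (S + 1) ≤ MvPolynomial.eval x.1 A * (S - 1)) ∨
        (f x = -1 ∧ 0 < |MvPolynomial.eval x.1 B| ∧
        |MvPolynomial.eval x.1 A| * (S + 1) ≤ |MvPolynomial.eval x.1 B| * (S - 1)) := by
      intro x
      have h1 := hlo x
      have h3 := hhi x
      rw [hf, evA, evB]
      set z := ∑ i, w i * x.1 i - θ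
      have pos : ∀ y : ℝ, 1 ≤ y → 0 < ∏ i ∈ Finset.range k, (y + S ^ (i + 1)) := by
        intro y hy
        exact Finset.prod_pos fun i _ => by positivity
      rcases lt_trichotomy z 0 with hz | hz | hz
      · right
        rw [abs_of_neg hz] at h1 h3
        rw [← hSk] at h3
        have e1 : |∏ i ∈ Finset.range k, (z + S ^ (i + 1))| =
            |∏ i ∈ Finset.range k, (-z - S ^ (i + 1))| := by
          rw [Finset.abs_prod, Finset.abs_prod]
          refine Finset.prod_congr rfl fun i _ => ?_
          rw [← abs_neg]; congr 1; ring
        have e2 : |∏ i ∈ Finset.range k, (z - S ^ (i + 1))| =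
            ∏ i ∈ Finset.range k, (-z + S ^ (i + 1)) := by
          rw [← abs_of_pos (pos (-z) h1), Finset.abs_prod, Finset.abs_prod]
          refine Finset.prod_congr rfl fun i _ => ?_
          rw [← abs_neg]; congr 1; ring
        rw [e1, e2]
        exact ⟨Real.sign_of_neg hz, pos _ h1, abs_prod_sub_mul_le_prod_add_mul hS1 h1 k hk1 h3⟩
      · rw [hz, abs_zero] at h1; linarith
      · left
        rw [abs_of_pos hz] at h1 h3
        rw [← hSk] at h3
        exact ⟨Real.sign_of_pos hz, pos _ h1, abs_prod_sub_mul_le_prod_add_mul hS1 h1 k hk1 h3⟩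
    refine RPlus_le_ofReal f d _ (A * A - B * B) (A * A + B * B)
      ((MvPolynomial.totalDegree_sub _ _).trans (max_le degAA degBB))
      ((MvPolynomial.totalDegree_add _ _).trans (max_le degAA degBB)) ?_ ?_
    · intro x hx
      rw [map_add, map_mul, map_mul]
      rcases cases ⟨x, hx⟩ with ⟨-, h, -⟩ | ⟨-, h, -⟩
      · have := mul_self_nonneg (MvPolynomial.eval x B); have := mul_pos h h
        dsimp only at *
        linarith
      · have := mul_self_nonneg (MvPolynomial.eval x A); have := mul_pos h h
        rw [abs_mul_abs_self] at this
        dsimp only at *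
        linarith
    · intro x
      refine le_trans ?_ hSd
      rw [map_add, map_sub, map_mul, map_mul]
      rcases cases x with ⟨h1, h3, h4⟩ | ⟨h1, h3, h4⟩
      · rw [h1]; exact abs_one_sub_sq_div_le hS1 h3 h4
      · have := abs_one_sub_sq_div_le hS1 h3 h4
        rw [abs_mul_abs_self] at this
        rw [h1, ← abs_neg]
        rw [add_comm (MvPolynomial.eval x.1 B * _)] at this
        refine le_of_eq_of_le (congrArg _ ?_) this
        ring

/-! ### The family of halfspaces -/

section Assembly

variable {α β : Type*} [Fintype α] [DecidableEq α] [Fintype β] [DecidableEq β]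

theorem sum_elim_mul_sumPoint {n : ℕ} (e : Fin n ≃ α ⊕ β) (w : α → ℝ) (v : ℝ)
    (A : Finset α) (B : Finset β) :
    ∑ i, Sum.elim w (fun _ => v) (e i) * sumPoint A B (e i) = ∑ i ∈ A, w i + v * B.card := by
  rw [Equiv.sum_comp e fun s => Sum.elim w (fun _ => v) s * sumPoint A B s]
  simp [Fintype.sum_sum_type, sumPoint, Finset.sum_ite_mem, mul_comm]

omit [Fintype α] [Fintype β] in
theorem sumPoint_comp_mem_boolCube {n : ℕ} (e : Fin n ≃ α ⊕ β) (A : Finset α) (B : Finset β) :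
    sumPoint A B ∘ e ∈ boolCube n := by
  intro i
  rw [Function.comp_apply]
  rcases e i with a | b
  · by_cases h : a ∈ A <;> simp [sumPoint, h]
  · by_cases h : b ∈ B <;> simp [sumPoint, h]

theorem exists_eq_sumPoint_comp {n : ℕ} (e : Fin n ≃ α ⊕ β) {x : Fin n → ℝ}
    (hx : x ∈ boolCube n) : ∃ A B, x = sumPoint A B ∘ e := by
  classical
  refine ⟨Finset.univ.filter fun a => x (e.symm (Sum.inl a)) = 1,
    Finset.univ.filter fun b => x (e.symm (Sum.inr b)) = 1, ?_⟩
  funext i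
  obtain ⟨s, rfl⟩ := e.symm.surjective i
  have h := hx (e.symm s)
  rw [Function.comp_apply, Equiv.apply_symm_apply]
  rcases s with a | b
  · rcases h with h | h <;> simp [sumPoint, h]
  · rcases h with h | h <;> simp [sumPoint, h]

theorem card_low_degree_bound {ι : Type*} [Fintype ι] [DecidableEq ι] (u : ℕ) (hu : 1 ≤ u)
    (h1 : 160 * u ≤ Fintype.card ι) (h2 : Fintype.card ι ≤ 160 * u + 160) :
    16 * ((2 ^ (20 * u) : ℕ) : ℝ) ^ 2 *
      ((Finset.univ.filter fun S : Finset ι => S.card ≤ 2 * u).card : ℝ) ^ 3 ≤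
        2 ^ Fintype.card ι := by
  have h := card_filter_card_le_mul_pow_le (ι := ι) (2 * u) (x := 1 / 32) (by norm_num)
    (by norm_num)
  set E := ((Finset.univ.filter fun S : Finset ι => S.card ≤ 2 * u).card : ℝ)
  have h3 : ((1 : ℝ) + 1 / 32) ^ Fintype.card ι ≤ 2 ^ (8 * u + 8) := by
    calc ((1 : ℝ) + 1 / 32) ^ Fintype.card ι ≤ (1 + 1 / 32) ^ (20 * (8 * u + 8)) :=
          pow_le_pow_right₀ (by norm_num) (by omega)
      _ = ((1 + 1 / 32) ^ 20) ^ (8 * u + 8) := pow_mul _ _ _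
      _ ≤ 2 ^ (8 * u + 8) := pow_le_pow_left₀ (by norm_num) (by norm_num) _
  have h4 : E ≤ 2 ^ (18 * u + 8) := by
    have e1 : ((1 : ℝ) / 32) ^ (2 * u) * 2 ^ (10 * u) = 1 := by
      rw [show 10 * u = 5 * (2 * u) by ring, pow_mul (2 : ℝ) 5, ← mul_pow]
      norm_num
    calc E = (E * (1 / 32) ^ (2 * u)) * 2 ^ (10 * u) := by rw [mul_assoc, e1, mul_one]
      _ ≤ 2 ^ (8 * u + 8) * 2 ^ (10 * u) := by
          gcongr
          exact h.trans h3
      _ = 2 ^ (18 * u + 8) := by rw [← pow_add]; congr 1; ring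
  push_cast
  calc 16 * ((2 : ℝ) ^ (20 * u)) ^ 2 * E ^ 3
      ≤ 16 * ((2 : ℝ) ^ (20 * u)) ^ 2 * (2 ^ (18 * u + 8)) ^ 3 := by gcongr
    _ = 2 ^ (4 + 20 * u * 2 + (18 * u + 8) * 3) := by
        rw [pow_add 2 (4 + 20 * u * 2), pow_add 2 4, pow_mul 2 (20 * u) 2,
          pow_mul 2 (18 * u + 8) 3, show (2 : ℝ) ^ 4 = 16 by norm_num]
    _ ≤ 2 ^ Fintype.card ι := pow_le_pow_right₀ (by norm_num) (by omega)

theorem eight_lt_exp_neg_mul_two_pow {n u d s : ℕ} (hd : 1 ≤ d) (hud : 10 * d ≤ u)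
    (hnu : n ≤ 400 * u) (hs : 20 * u ≤ (s + 1) * (2 * d + 2)) :
    8 < Real.exp (-(1 / 400 * (n / d : ℝ))) * 2 ^ s := by
  have hd0 : (0 : ℝ) < d := by exact_mod_cast hd
  set y : ℝ := u / d with hy
  have hy10 : 10 ≤ y := by
    rw [hy, le_div_iff₀ hd0]; exact_mod_cast hud
  have hn : 1 / 400 * (n / d : ℝ) ≤ y := by
    rw [hy, ← mul_div_assoc]
    gcongr
    have : (n : ℝ) ≤ 400 * u := by exact_mod_cast hnu
    linarith
  have hsy : 5 * y ≤ s + 1 := by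
    rw [hy, ← mul_div_assoc, div_le_iff₀ hd0]
    have h1 : (20 * u : ℝ) ≤ (s + 1) * (2 * d + 2) := by exact_mod_cast hs
    have h2 : (1 : ℝ) ≤ d := by exact_mod_cast hd
    have h3 : (0 : ℝ) ≤ s + 1 := by positivity
    nlinarith
  have hs3 : 3 ≤ s := by
    have : (3 : ℝ) ≤ s := by linarith
    exact_mod_cast this
  obtain ⟨t, rfl⟩ := Nat.exists_eq_add_of_le hs3
  push_cast at hsy
  have hexp : Real.exp ((t : ℝ) / 2) ≤ 2 ^ t := by
    have h1 : Real.exp (1 / 2) ≤ 2 := by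
      have := Real.exp_one_lt_d9
      have e : Real.exp (1 / 2) * Real.exp (1 / 2) = Real.exp 1 := by
        rw [← Real.exp_add]; norm_num
      nlinarith [Real.exp_pos (1 / 2 : ℝ)]
    calc Real.exp ((t : ℝ) / 2) = Real.exp (1 / 2) ^ t := by
          rw [← Real.exp_nat_mul]; congr 1; ring
      _ ≤ 2 ^ t := by gcongr
  have hlt : Real.exp y < Real.exp ((t : ℝ) / 2) := Real.exp_lt_exp.2 (by linarith)
  have h5 : Real.exp (-y) ≤ Real.exp (-(1 / 400 * (n / d : ℝ))) :=
    Real.exp_le_exp.2 (neg_le_neg hn)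
  have h6 : Real.exp (-y) * Real.exp y = 1 := by rw [← Real.exp_add]; simp
  rw [pow_add]
  have h7 : 1 < Real.exp (-(1 / 400 * (n / d : ℝ))) * 2 ^ t := by
    calc 1 = Real.exp (-y) * Real.exp y := h6.symm
      _ < Real.exp (-y) * 2 ^ t := by
          have := Real.exp_pos (-y)
          gcongr
          linarith
      _ ≤ _ := by gcongr
  linarith

theorem isHalfspace_one (n : ℕ) : IsHalfspace (fun _ : boolCube n => (1 : ℝ)) :=
  ⟨0, -1, fun x => by simp [Real.sign_of_pos]⟩

/-- The function `f` has approximation error at least `1 - δ` in degree `d` if no positive `q` and `p`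
of degree `d` satisfy `δ q ≤ f p ≤ 2 q`. -/
theorem ofReal_le_RPlus {n : ℕ} {X : Set (Fin n → ℝ)} (f : X → ℝ) (d : ℕ) {δ : ℝ} (hδ : 0 < δ)
    (h : ∀ p q : MvPolynomial (Fin n) ℝ, p.totalDegree ≤ d → q.totalDegree ≤ d →
      (∀ x ∈ X, 0 < MvPolynomial.eval x q) →
      (∀ x : X, f x = 1 → δ * MvPolynomial.eval x.1 q ≤ MvPolynomial.eval x.1 p ∧
        MvPolynomial.eval x.1 p ≤ 2 * MvPolynomial.eval x.1 q) →
      (∀ x : X, f x = -1 → δ * MvPolynomial.eval x.1 q ≤ -MvPolynomial.eval x.1 p ∧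
        -MvPolynomial.eval x.1 p ≤ 2 * MvPolynomial.eval x.1 q) → False) :
    ENNReal.ofReal (1 - δ) ≤ RPlus f d := by
  refine le_iInf fun p => le_iInf fun q => le_iInf fun ⟨hp, hq, hpos⟩ => ?_
  by_contra! hlt
  have hx : ∀ x : X, |f x - MvPolynomial.eval x.1 p / MvPolynomial.eval x.1 q| < 1 - δ := by
    intro x
    have h1 := (le_iSup (fun x : X => ENNReal.ofReal
      |f x - MvPolynomial.eval x.1 p / MvPolynomial.eval x.1 q|) x).trans_lt hlt
    exact (ENNReal.ofReal_lt_ofReal_iff_of_nonneg (abs_nonneg _)).1 h1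
  refine h p q hp hq hpos (fun x hfx => ?_) (fun x hfx => ?_)
  · have h1 := abs_lt.1 (hx x)
    have h2 := hpos x.1 x.2
    rw [hfx] at h1
    rw [← le_div_iff₀ h2, ← div_le_iff₀ h2]
    constructor <;> linarith
  · have h1 := abs_lt.1 (hx x)
    have h2 := hpos x.1 x.2
    rw [hfx] at h1
    rw [← le_div_iff₀ h2, ← div_le_iff₀ h2, neg_div]
    constructor <;> linarith

theorem exists_halfspace_RPlus_bounds (n : ℕ) (hn : 4000 ≤ n) :
    ∃ f : boolCube n → ℝ, IsHalfspace f ∧ ∀ d : ℕ, 1 ≤ d → 4000 * d ≤ n →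
      ENNReal.ofReal (1 - Real.exp (-(1 / 400 * (n / d : ℝ)))) ≤ RPlus f d ∧
      RPlus f d ≤ ENNReal.ofReal (1 - Real.exp (-(9 * (n / d : ℝ)))) := by
  set N := (n - 2) / 2 with hN
  set u := N / 160 with hu
  have e : Fin n ≃ Fin N ⊕ Fin (n - N) :=
    (finCongr (by omega : n = N + (n - N))).trans finSumFinEquiv.symm
  have hcα : Fintype.card (Fin N) = N := Fintype.card_fin N
  have hcβ : Fintype.card (Fin (n - N)) = n - N := Fintype.card_fin _
  obtain ⟨w, w₀, hbd, hard⟩ := exists_hard_affine_form (α := Fin N) (β := Fin (n - N)) u (20 * u)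
    (by omega) (by rw [hcα, hcβ]; omega)
    (card_low_degree_bound u (by omega) (by rw [hcα]; omega) (by rw [hcα]; omega))
  set ℓ : Finset (Fin N) → Finset (Fin (n - N)) → ℤ :=
    fun A B => w₀ + ∑ i ∈ A, w i - 2 ^ (20 * u) * B.card with hℓ
  set W : Fin n → ℝ := fun i =>
    Sum.elim (fun a => 2 * (w a : ℝ)) (fun _ => -(2 * 2 ^ (20 * u) : ℝ)) (e i) with hW
  set θ : ℝ := -(2 * w₀ + 1) with hθ
  have hval : ∀ A B, ∑ i, W i * (sumPoint A B ∘ e) i - θ = ((2 * ℓ A B + 1 : ℤ) : ℝ) := by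
    intro A B
    simp only [hW, Function.comp_apply]
    rw [sum_elim_mul_sumPoint, ← Finset.mul_sum]
    simp only [hθ, hℓ]
    push_cast
    ring
  have hlo : ∀ x : boolCube n, 1 ≤ |∑ i, W i * x.1 i - θ| := by
    intro x
    obtain ⟨A, B, hx⟩ := exists_eq_sumPoint_comp e x.2
    rw [hx, hval, ← Int.cast_abs]
    have : 1 ≤ |2 * ℓ A B + 1| := Int.one_le_abs (by omega)
    exact_mod_cast this
  have hhi : ∀ x : boolCube n, |∑ i, W i * x.1 i - θ| ≤ Real.exp (3 * n) := by
    intro x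
    obtain ⟨A, B, hx⟩ := exists_eq_sumPoint_comp e x.2
    rw [hx, hval, ← Int.cast_abs]
    have h1 : |ℓ A B| ≤ n * 2 ^ n := by
      refine (hbd A B).trans ?_
      rw [hcβ]
      have : ((n - N : ℕ) : ℤ) ≤ n := by exact_mod_cast Nat.sub_le n N
      have h20 : (2 : ℤ) ^ (20 * u) ≤ 2 ^ n := pow_le_pow_right₀ (by norm_num) (by omega)
      exact mul_le_mul this h20 (by positivity) (by positivity)
    have h2 : |2 * ℓ A B + 1| ≤ 2 * (n * 2 ^ n) + 1 := by
      calc |2 * ℓ A B + 1| ≤ |2 * ℓ A B| + |1| := abs_add_le _ _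
        _ = 2 * |ℓ A B| + 1 := by rw [abs_mul]; norm_num
        _ ≤ _ := by linarith
    have h3 : ((|2 * ℓ A B + 1| : ℤ) : ℝ) ≤ 2 * (n * 2 ^ n) + 1 := by exact_mod_cast h2
    refine h3.trans ?_
    have h4 : (n : ℝ) + 1 ≤ 2 ^ n := by
      have := Nat.lt_two_pow_self (n := n)
      exact_mod_cast this
    have h5 : (2 : ℝ) ^ n ≤ Real.exp n := by
      have h : (2 : ℝ) ≤ Real.exp 1 := by
        have := Real.add_one_le_exp (1 : ℝ); linarith
      calc (2 : ℝ) ^ n ≤ Real.exp 1 ^ n := by gcongr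
        _ = Real.exp n := by rw [← Real.exp_nat_mul, mul_one]
    have h6 : (4 : ℝ) ≤ 2 ^ n := by
      calc (4 : ℝ) = 2 ^ 2 := by norm_num
        _ ≤ 2 ^ n := pow_le_pow_right₀ (by norm_num) (by omega)
    have hn0 : (0 : ℝ) ≤ n := Nat.cast_nonneg n
    calc 2 * ((n : ℝ) * 2 ^ n) + 1 ≤ 2 ^ n * (2 ^ n * 2 ^ n) := by nlinarith
      _ ≤ Real.exp n * (Real.exp n * Real.exp n) := by gcongr
      _ = Real.exp (3 * n) := by rw [← Real.exp_add, ← Real.exp_add]; congr 1; ring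
  refine ⟨fun x => Real.sign (∑ i, W i * x.1 i - θ), ⟨W, θ, fun x => ⟨?_, rfl⟩⟩, ?_⟩
  · intro h0
    have := hlo x
    rw [h0, abs_zero] at this
    linarith
  intro d hd hdn
  constructor
  · refine ofReal_le_RPlus _ d (Real.exp_pos _) fun p q hp hq hqpos hpos hneg => ?_
    set s := (20 * u - 1) / (2 * d + 2) with hs
    have hud : 10 * d ≤ u := by omega
    have hs1 : s * (2 * d + 2) ≤ 20 * u - 1 := Nat.div_mul_le_self _ _
    have hs2 : 20 * u - 1 < (s + 1) * (2 * d + 2) := by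
      rw [mul_comm (s + 1)]; exact Nat.lt_mul_div_succ _ (by omega)
    have hs3 : 1 ≤ s := by
      rw [hs, Nat.one_le_div_iff (by omega)]; omega
    have hlt := eight_lt_exp_neg_mul_two_pow (n := n) (s := s) hd hud (by omega)
      (Nat.le_of_pred_lt hs2)
    refine absurd (hard d s _ (MvPolynomial.rename e p) (MvPolynomial.rename e q) (by omega) hs3
      (by omega) (Real.exp_pos _) ((MvPolynomial.totalDegree_rename_le _ _).trans hp)
      ((MvPolynomial.totalDegree_rename_le _ _).trans hq) ?_ ?_ ?_) (not_le.2 hlt)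
    · intro A B
      rw [MvPolynomial.eval_rename]
      exact hqpos _ (sumPoint_comp_mem_boolCube e A B)
    · intro A B hAB
      rw [MvPolynomial.eval_rename, MvPolynomial.eval_rename]
      refine hpos ⟨_, sumPoint_comp_mem_boolCube e A B⟩ (Real.sign_of_pos ?_)
      rw [hval, Int.cast_pos]
      simp only [hℓ]; omega
    · intro A B hAB
      rw [MvPolynomial.eval_rename, MvPolynomial.eval_rename]
      refine hneg ⟨_, sumPoint_comp_mem_boolCube e A B⟩ (Real.sign_of_neg ?_)
      rw [hval, Int.cast_lt_zero]
      simp only [hℓ]; omega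
  · have h := RPlus_sign_le (X := boolCube n) (fun x => Real.sign (∑ i, W i * x.1 i - θ)) W θ
      (fun _ => rfl) (K := 3 * n) (by positivity) hlo hhi d hd
    refine h.trans_eq ?_
    congr 4
    ring

end Assembly

theorem theorem6p2 :
    ∃ h : (n : ℕ) → boolCube n → ℝ,
      (∀ n : ℕ, 1 ≤ n → IsHalfspace (h n)) ∧
      ∃ c a b : ℝ, 0 < c ∧ 0 < a ∧ 0 < b ∧
        ∀ n d : ℕ, 1 ≤ n → 1 ≤ d → (d : ℝ) ≤ c * n →
          ENNReal.ofReal (1 - Real.exp (-(a * (n / d : ℝ)))) ≤ RPlus (h n) d ∧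
          RPlus (h n) d ≤ ENNReal.ofReal (1 - Real.exp (-(b * (n / d : ℝ)))) := by
  classical
  have H : ∀ n : ℕ, ∃ f : boolCube n → ℝ, IsHalfspace f ∧ ∀ d : ℕ, 1 ≤ d → 4000 * d ≤ n →
      ENNReal.ofReal (1 - Real.exp (-(1 / 400 * (n / d : ℝ)))) ≤ RPlus f d ∧
      RPlus f d ≤ ENNReal.ofReal (1 - Real.exp (-(9 * (n / d : ℝ)))) := by
    intro n
    by_cases hn : 4000 ≤ n
    · exact exists_halfspace_RPlus_bounds n hn
    · exact ⟨_, isHalfspace_one n, fun d hd hdn => by omega⟩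
  choose h hh hb using H
  refine ⟨h, fun n _ => hh n, 1 / 4000, 1 / 400, 9, by norm_num, by norm_num, by norm_num,
    fun n d _ hd hdn => hb n d hd ?_⟩
  have : (4000 * d : ℝ) ≤ n := by linarith
  exact_mod_cast this
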